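/- Let $\mathbb T$ be the unit circle with normalized Lebesgue measure $m$, let $L^p=L^p(\mathbb T,m)$, and for $p\in\{1,2\}$ let $H^p\subset L^p$ be the Hardy space, i.e. the space of all $f\in L^p$ whose Fourier coefficients of negative index vanish (equivalently, the boundary traces of the functions in the Hardy space $H^p$ of the unit disk). For $\varphi\in L^\infty$ let $T_\varphi f=P_+(\varphi f)$, $f\in H^2$, be the Toeplitz operator with symbol $\varphi$, where $P_+$ is the orthogonal projection of $L^2$ onto $H^2$, and put $$K_2(\varphi)=\{f\in H^2:\ T_\varphi f=0\},\qquad V_\varphi=\{|f|^2:\ f\in K_2(\varphi),\ 0<\|f\|_2\le 1\}\subset L^1 .$$ A function $F$ on $\mathbb T$ is called outer if $F=\lambda\exp\{\log w+i\mathcal H(\log w)\}$ a.e. for some constant $\lambda\in\mathbb C$ with $|\lambda|=1$ and some nonnegative function $w$ on $\mathbb T$ with $\log w\in L^1$, where $\mathcal H$ is the harmonic conjugation operator ($\mathcal Hu$ is the a.e. radial limit of the conjugate Poisson integral of $u$). Suppose that $\varphi\in L^\infty\setminus\{0\}$ is such that $K_2(\varphi)\ne\{0\}$, and let $g\in V_\varphi$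 be a function with $\|g\|_1=1$. Then $g$ is an extreme point of $V_\varphi$ if and only if $\bar z\bar\varphi g$ is an outer function in $H^1$. -/

import Mathlib

open MeasureTheory Filter Topology AddCircle
open scoped ENNReal ComplexConjugate

noncomputable section

namespace ToeplitzKernel

/-- The unit circle, parametrized by `t ∈ ℝ / ℤ` through `ζ = exp (2 π i t)`. -/
abbrev Circ : Type := UnitAddCircle

/-- Normalized Lebesgue measure on the unit circle. -/
abbrev m : Measure Circ := haarAddCircle

/-- The coordinate function `z` on the unit circle, `z t = exp (2 π i t)`. -/
def z (t : Circ) : ℂ := (toCircle t : ℂ)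

/-- A function on the circle is (the boundary function of) an element of the Hardy space `H^p`,
`1 ≤ p ≤ ∞`: it lies in `L^p` and its Fourier coefficients of negative index vanish. -/
def MemHardy (p : ℝ≥0∞) (F : Circ → ℂ) : Prop :=
  MemLp F p m ∧ ∀ n : ℤ, n < 0 → fourierCoeff F n = 0

/-- The Fourier coefficients of an `L^2` function as inner products. -/
theorem fourierCoeff_eq_inner (f : Lp ℂ 2 m) (n : ℤ) :
    fourierCoeff f n = inner ℂ (fourierLp (T := 1) 2 n) f := by
  rw [← fourierBasis_repr, HilbertBasis.repr_apply_apply, coe_fourierBasis]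

/-- The Hardy space `H^2` as a subspace of `L^2`. -/
def H2 : Submodule ℂ (Lp ℂ 2 m) where
  carrier := {f | MemHardy 2 f}
  zero_mem' := ⟨Lp.memLp _, fun n _ => by rw [fourierCoeff_eq_inner, inner_zero_right]⟩
  add_mem' := fun {f g} hf hg => ⟨Lp.memLp _, fun n hn => by
    have h1 := hf.2 n hn
    have h2 := hg.2 n hn
    rw [fourierCoeff_eq_inner] at h1 h2 ⊢
    rw [inner_add_right, h1, h2, add_zero]⟩
  smul_mem' := fun c f hf => ⟨Lp.memLp _, fun n hn => by
    have h1 := hf.2 n hn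
    rw [fourierCoeff_eq_inner] at h1 ⊢
    rw [inner_smul_right, h1, mul_zero]⟩

theorem isClosed_H2 : IsClosed (H2 : Set (Lp ℂ 2 m)) := by
  have h : (H2 : Set (Lp ℂ 2 m)) =
      ⋂ n : ℤ, ⋂ _ : n < 0, {f | inner ℂ (fourierLp (T := 1) 2 n) f = (0 : ℂ)} := by
    ext f
    simp only [Set.mem_iInter, Set.mem_ofPred_eq]
    constructor
    · intro hf n hn
      rw [← fourierCoeff_eq_inner]
      exact hf.2 n hn
    · intro hf
      refine ⟨Lp.memLp _, fun n hn => ?_⟩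
      rw [fourierCoeff_eq_inner]
      exact hf n hn
  rw [h]
  refine isClosed_iInter fun n => isClosed_iInter fun _ => ?_
  exact isClosed_eq (continuous_const.inner continuous_id) continuous_const

instance instCompleteSpaceH2 : CompleteSpace H2 := isClosed_H2.completeSpace_coe

/-- The Toeplitz operator with symbol `φ ∈ L^∞` on `H^2`: `T_φ f = P_+ (φ f)`, where `P_+` is the
orthogonal projection of `L^2` onto `H^2`. -/
def toeplitz (φ : Lp ℂ ∞ m) (f : H2) : H2 :=
  H2.orthogonalProjectionOnto (φ • (f : Lp ℂ 2 m) : Lp ℂ 2 m)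

/-- The kernel `K_2(φ)` of the Toeplitz operator `T_φ` in `H^2`. -/
def K2 (φ : Lp ℂ ∞ m) : Set H2 := {f | toeplitz φ f = 0}

/-- The set `V_φ = {|f|^2 : f ∈ K_2(φ), 0 < ‖f‖_2 ≤ 1}`, a subset of the real space `L^1`. -/
def V (φ : Lp ℂ ∞ m) : Set (Lp ℝ 1 m) :=
  {g | ∃ f ∈ K2 φ, 0 < ‖f‖ ∧ ‖f‖ ≤ 1 ∧ ∀ᵐ t ∂m, g t = ‖(f : Lp ℂ 2 m) t‖ ^ 2}

/-- The conjugate Poisson integral of `u` at a point `a` of the unit disk: the imaginary part of the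
analytic function `∫ (ζ + a) / (ζ - a) u(ζ) dm(ζ)`, whose real part is the Poisson integral. -/
def conjPoisson (u : Circ → ℝ) (a : ℂ) : ℝ :=
  ∫ s, ((z s + a) / (z s - a)).im * u s ∂m

/-- The harmonic conjugation operator on real functions in `L^1`: the radial limit, which exists
almost everywhere, of the conjugate Poisson integral. -/
def harmonicConj (u : Circ → ℝ) (t : Circ) : ℝ :=
  limUnder (𝓝[<] (1 : ℝ)) (fun r : ℝ => conjPoisson u ((r : ℂ) * z t))

/-- The outer function `O_w = exp (log w + i H (log w))`, where `H` is harmonic conjugation. -/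
def outerFun (w : Circ → ℝ) (t : Circ) : ℂ :=
  Complex.exp ((Real.log (w t) : ℂ) + Complex.I * (harmonicConj (fun s => Real.log (w s)) t : ℂ))

/-- A function on the circle is outer if it agrees a.e. with `c O_w` for some unimodular constant
`c` and some nonnegative `w` with `log w ∈ L^1`. As `Real.log 0 = 0`, the condition that `log w`
is finite a.e. is stated as `w > 0` a.e. -/
def IsOuter (F : Circ → ℂ) : Prop :=
  ∃ (c : ℂ) (w : Circ → ℝ), ‖c‖ = 1 ∧ (∀ᵐ t ∂m, 0 < w t) ∧
    Integrable (fun t => Real.log (w t)) m ∧ ∀ᵐ t ∂m, F t = c * outerFun w t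

end ToeplitzKernel

end

/-!
For `g ∈ V φ` write `F = conj z * conj φ * g` (`companion φ g`). If `g = ‖f‖²` with `T_φ f = 0`, then
`F` is the product of `f` and `conj z * conj φ * conj f`, which are both in `H²`, so `F ∈ H¹`
(`of_mem_V`). Conversely, if `g ≥ 0` has norm in `(0, 1]` and `F ∈ H¹`, then `log g` is integrable and
the outer function with modulus `g ^ (1 / 2)` is in the kernel of `T_φ`, so `g ∈ V φ`
(`mem_V_of_companion`). Thus `V φ` is described by a linear condition, and extremality becomes a
question about `H¹`:

* If `F` is outer and `g = a g₁ + b g₂` in `V φ`, then `g₁ / g` is the quotient of the companion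
  functions, is bounded, and lies in `H¹` because one may divide by outer functions. Real functions
  in `H¹` are constant, so `g₁ = g` (`mem_extremePoints_of_isOuter`).
* If `F` is not outer, its inner factor is not constant. Let `J` be a unimodular multiple of that
  factor with `∫ g Re J = 0`. Then `F Re J ∈ H¹`, so `g (1 ± Re J) ∈ V φ`, and `g` is the midpoint of
  these two functions (`isOuter_of_mem_extremePoints`).

The Hardy space theory behind this is reduced to the outer functions
`outerBdry u = exp (u + i H u)`, `u ∈ L¹`. They are boundary values of `outerExt u`, the exponential
of the Herglotz integral of `u` (`ae_tendsto_outerExt`): Fatou's theorem for Poisson integrals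
(`ae_tendsto_poisson`) gives radial limits of moduli and, with Parseval's identity, of bounded outer
functions; quotients give the general case; and a continuous angle whose direction converges
converges itself, which gives the radial limits of the conjugate Poisson integral. The key fact is
`outerBdry_mul`: if `F ∈ H¹` and `outerBdry u * F` is integrable, then it is in `H¹`, and its mean is
`exp (∫ u)` times that of `F`. It implies that `log ‖F‖` is integrable for nonzero `F ∈ H¹`
(`MemHardy.log_integrable`), and that `F` can be divided by its outer factor.
-/

noncomputable section

namespace ToeplitzKernel

/-! ### The coordinate function and kernel integrals at Lebesgue points -/

theorem norm_z (t : Circ) : ‖z t‖ = 1 := Circle.norm_coe _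

theorem z_ne_zero (t : Circ) : z t ≠ 0 := Circle.coe_ne_zero _

theorem continuous_z : Continuous z := continuous_subtype_val.comp continuous_toCircle

theorem conj_z_mul_z (t : Circ) : conj (z t) * z t = 1 := by
  rw [mul_comm, Complex.mul_conj, Complex.normSq_eq_norm_sq, norm_z]; simp

theorem volume_eq_m : (volume : Measure Circ) = m := by
  rw [volume_eq_smul_haarAddCircle]; simp

/-- Near the boundary the denominator `‖ζ - r η‖²` of the Poisson kernel is at least the sum of the
squares of `1 - r` and of the distance between the two points on the circle `ℝ / ℤ`. -/
theorem norm_z_sub_sq_lower {r : ℝ} (hr : 1 / 2 ≤ r) (s t : Circ) :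
    (1 - r) ^ 2 + dist s t ^ 2 ≤ ‖z s - (r : ℂ) * z t‖ ^ 2 := by
  have h1 : ‖z s - (r : ℂ) * z t‖ = ‖z (s - t) - r‖ := by
    have : z s - (r : ℂ) * z t = (z (s - t) - r) * z t := by
      rw [sub_mul]; congr 1
      unfold z; rw [← Circle.coe_mul, ← toCircle_add, sub_add_cancel]
    rw [this, norm_mul, norm_z, mul_one]
  rw [h1, dist_eq_norm]
  generalize s - t = x
  induction x using QuotientAddGroup.induction_on with
  | H y =>
  change (1 - r) ^ 2 + ‖(y : Circ)‖ ^ 2 ≤ ‖z (y : Circ) - r‖ ^ 2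
  have hz : z (y : Circ) = Complex.exp ((2 * Real.pi * y : ℝ) * Complex.I) := by
    unfold z; rw [toCircle_apply_mk, Circle.coe_exp]; simp
  have hq : ‖z (y : Circ) - r‖ ^ 2 = 1 - 2 * r * Real.cos (2 * Real.pi * y) + r ^ 2 := by
    rw [hz, ← Complex.normSq_eq_norm_sq, Complex.normSq_apply, Complex.sub_re, Complex.sub_im,
      Complex.exp_ofReal_mul_I_re, Complex.exp_ofReal_mul_I_im, Complex.ofReal_re,
      Complex.ofReal_im]
    nlinarith [Real.sin_sq_add_cos_sq (2 * Real.pi * y)]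
  have hc : Real.cos (2 * Real.pi * y) ≤ 1 - 8 * (y - round y) ^ 2 := by
    have e : Real.cos (2 * Real.pi * y) = Real.cos (2 * Real.pi * (y - round y)) := by
      rw [← Real.cos_sub_int_mul_two_pi _ (round y)]; ring_nf
    have hy := abs_sub_round y
    have h2 : |2 * Real.pi * (y - round y)| ≤ Real.pi := by
      rw [abs_mul, abs_of_pos (by positivity)]
      nlinarith [Real.pi_pos]
    refine e.trans_le ((Real.cos_le_one_sub_mul_cos_sq h2).trans (le_of_eq ?_))
    field_simp; ring
  rw [hq, UnitAddCircle.norm_eq, sq_abs]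
  nlinarith [sq_nonneg (y - round y), mul_le_mul_of_nonneg_left hc (by linarith : 0 ≤ 2 * r)]

/-- The kernel `δ / (δ² + x²)` is dominated by a sum of multiples of indicator functions of the
dyadic dilates `[0, 2ᵏ δ]`, with masses decaying geometrically in `k`. -/
theorem exists_dyadic_bound {δ : ℝ} (hδ : 0 < δ) (x : ℝ) :
    ∃ k : ℕ, x ≤ 2 ^ k * δ ∧ δ / (δ ^ 2 + x ^ 2) ≤ 4 * (1 / 4) ^ k / δ := by
  have hex : ∃ k : ℕ, x ≤ 2 ^ k * δ := by
    obtain ⟨k, hk⟩ := pow_unbounded_of_one_lt (x / δ) (one_lt_two : (1 : ℝ) < 2)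
    exact ⟨k, ((div_lt_iff₀ hδ).1 hk).le⟩
  classical
  refine ⟨Nat.find hex, Nat.find_spec hex, ?_⟩
  rw [div_le_div_iff₀ (by positivity) hδ]
  rcases h : Nat.find hex with _ | j
  · simp; nlinarith [sq_nonneg x, sq_nonneg δ]
  · have hj : 2 ^ j * δ < x := not_le.1 (Nat.find_min hex (by omega : j < Nat.find hex))
    have h4 : (1 / 4 : ℝ) ^ j * (2 ^ j) ^ 2 = 1 := by
      rw [← pow_mul, mul_comm j 2, pow_mul, ← mul_pow]; norm_num
    have h5 : (2 ^ j * δ) ^ 2 ≤ x ^ 2 := pow_le_pow_left₀ (by positivity) hj.le 2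
    have h6 : δ * δ ≤ (1 / 4) ^ j * x ^ 2 := by
      calc δ * δ = (1 / 4 : ℝ) ^ j * (2 ^ j * δ) ^ 2 := by rw [mul_pow, ← mul_assoc, h4]; ring
        _ ≤ _ := by gcongr
    have : 0 ≤ (1 / 4 : ℝ) ^ j * δ ^ 2 := by positivity
    rw [pow_succ]; nlinarith

/-- At a point where the means of `v` over small balls tend to `0`, the integrals of `v` against the
Cauchy-type kernels `δ / (δ² + x²)` tend to `0`. -/
theorem tendsto_integral_kernel {v : Circ → ℝ} (hv : Integrable v m) (hv0 : ∀ s, 0 ≤ v s) {t : Circ}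
    (h : Tendsto (fun ρ : ℝ => ⨍ s in Metric.closedBall t ρ, v s ∂m) (𝓝[>] 0) (𝓝 0)) :
    Tendsto (fun δ : ℝ => ∫ s, δ / (δ ^ 2 + dist s t ^ 2) * v s ∂m) (𝓝[>] 0) (𝓝 0) := by
  set A : ℝ → ℝ := fun ρ => ∫ s in Metric.closedBall t ρ, v s ∂m with hA
  have hA0 : ∀ ρ, 0 ≤ A ρ := fun ρ => integral_nonneg hv0
  have hAle : ∀ ρ, A ρ ≤ ∫ s, v s ∂m := fun ρ =>
    setIntegral_le_integral hv (Eventually.of_forall hv0)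
  have hAlim : Tendsto (fun ρ => A ρ / ρ) (𝓝[>] 0) (𝓝 0) := by
    have h2 := h.const_mul 2
    rw [mul_zero] at h2
    refine squeeze_zero' ?_ ?_ h2
    · filter_upwards [self_mem_nhdsWithin] with ρ hρ using div_nonneg (hA0 _) (le_of_lt hρ)
    · filter_upwards [self_mem_nhdsWithin] with ρ hρ
      have hρ : 0 < ρ := hρ
      have hm : m.real (Metric.closedBall t ρ) ≤ 2 * ρ := by
        rw [← volume_eq_m, Measure.real, AddCircle.volume_closedBall,
          ENNReal.toReal_ofReal (by positivity)]
        exact min_le_right _ _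
      have hm0 : 0 < m.real (Metric.closedBall t ρ) := by
        rw [← volume_eq_m, Measure.real, AddCircle.volume_closedBall,
          ENNReal.toReal_ofReal (by positivity)]
        positivity
      rw [setAverage_eq, smul_eq_mul, div_le_iff₀ hρ]
      calc A ρ = (m.real (Metric.closedBall t ρ))⁻¹ * A ρ * m.real (Metric.closedBall t ρ) := by
            field_simp
        _ ≤ (m.real (Metric.closedBall t ρ))⁻¹ * A ρ * (2 * ρ) := by
            gcongr
            exact mul_nonneg (by positivity) (hA0 _)
        _ = _ := by simp only [hA]; ring
  obtain ⟨M, hM⟩ : ∃ M, ∀ ρ, 0 < ρ → A ρ / ρ ≤ M := by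
    have := hAlim.eventually (ge_mem_nhds (zero_lt_one : (0 : ℝ) < 1))
    rw [eventually_nhdsWithin_iff, Metric.eventually_nhds_iff] at this
    obtain ⟨ρ₀, hρ₀, h1⟩ := this
    refine ⟨max 1 ((∫ s, v s ∂m) / ρ₀), fun ρ hρ => ?_⟩
    by_cases hlt : ρ < ρ₀
    · exact le_max_of_le_left (h1 (by simpa [abs_of_pos hρ] using hlt) hρ)
    · refine le_max_of_le_right ?_
      exact div_le_div₀ (integral_nonneg hv0) (hAle _) hρ₀ (not_lt.1 hlt)
  have hdom : ∀ δ : ℝ, 0 < δ → ∀ k : ℕ,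
      4 * (1 / 4) ^ k / δ * A (2 ^ k * δ) = 4 * (1 / 2) ^ k * (A (2 ^ k * δ) / (2 ^ k * δ)) := by
    intro δ hδ k
    have : (1 / 4 : ℝ) ^ k = (1 / 2) ^ k * (1 / 2) ^ k := by rw [← mul_pow]; norm_num
    have h2 : (1 / 2 : ℝ) ^ k * 2 ^ k = 1 := by rw [← mul_pow]; norm_num
    rw [this]; field_simp
    rw [h2, one_mul]
  have hsum : Summable fun k : ℕ => 4 * (1 / 2 : ℝ) ^ k * M :=
    (summable_geometric_two.mul_left 4).mul_right M
  have hlim : Tendsto (fun δ : ℝ => ∑' k : ℕ, 4 * (1 / 2) ^ k * (A (2 ^ k * δ) / (2 ^ k * δ)))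
      (𝓝[>] 0) (𝓝 (∑' k : ℕ, 4 * (1 / 2) ^ k * 0)) := by
    refine tendsto_tsum_of_dominated_convergence hsum (fun k => ?_) ?_
    · refine Tendsto.const_mul _ (hAlim.comp ?_)
      refine tendsto_nhdsWithin_iff.2 ⟨?_, ?_⟩
      · have : Tendsto (fun δ : ℝ => 2 ^ k * δ) (𝓝 0) (𝓝 (2 ^ k * 0)) :=
          tendsto_id.const_mul _
        rw [mul_zero] at this
        exact this.mono_left nhdsWithin_le_nhds
      · filter_upwards [self_mem_nhdsWithin] with δ hδ
        exact mul_pos (pow_pos two_pos k) (Set.mem_Ioi.1 hδ)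
    · filter_upwards [self_mem_nhdsWithin] with δ hδ k
      have hδ : 0 < δ := hδ
      have : 0 ≤ A (2 ^ k * δ) / (2 ^ k * δ) := div_nonneg (hA0 _) (by positivity)
      rw [Real.norm_of_nonneg (by positivity)]
      have := hM (2 ^ k * δ) (by positivity)
      gcongr
  simp only [mul_zero, tsum_zero] at hlim
  refine squeeze_zero' ?_ ?_ hlim
  · filter_upwards [self_mem_nhdsWithin] with δ hδ
    have hδ : 0 < δ := hδ
    exact integral_nonneg fun s => mul_nonneg (by positivity) (hv0 s)
  · filter_upwards [self_mem_nhdsWithin] with δ hδ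
    have hδ : 0 < δ := hδ
    have hsm : Summable fun k : ℕ => 4 * (1 / 4) ^ k / δ * A (2 ^ k * δ) := by
      refine Summable.of_nonneg_of_le (fun k => mul_nonneg (by positivity) (hA0 _)) (fun k => ?_)
        hsum
      rw [hdom δ hδ]
      have := hM (2 ^ k * δ) (by positivity)
      gcongr
    simp_rw [← hdom δ hδ]
    have hnn : 0 ≤ᵐ[m] fun s => δ / (δ ^ 2 + dist s t ^ 2) * v s :=
      Eventually.of_forall fun s => mul_nonneg (by positivity) (hv0 s)
    by_cases hint : Integrable (fun s => δ / (δ ^ 2 + dist s t ^ 2) * v s) m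
    swap
    · rw [integral_undef hint]
      exact tsum_nonneg fun k => mul_nonneg (by positivity) (hA0 _)
    rw [← ENNReal.ofReal_le_ofReal_iff (tsum_nonneg fun k => mul_nonneg (by positivity) (hA0 _)),
      ofReal_integral_eq_lintegral_ofReal hint hnn,
      ENNReal.ofReal_tsum_of_nonneg (fun k => mul_nonneg (by positivity) (hA0 _)) hsm]
    calc ∫⁻ s, ENNReal.ofReal (δ / (δ ^ 2 + dist s t ^ 2) * v s) ∂m
        ≤ ∫⁻ s, ∑' k : ℕ, ENNReal.ofReal (4 * (1 / 4) ^ k / δ) *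
            (Metric.closedBall t (2 ^ k * δ)).indicator (fun s => ENNReal.ofReal (v s)) s ∂m := by
          refine lintegral_mono fun s => ?_
          obtain ⟨k, hk1, hk2⟩ := exists_dyadic_bound hδ (dist s t)
          refine le_trans ?_ (ENNReal.le_tsum k)
          rw [Set.indicator_of_mem (by simpa using hk1), ← ENNReal.ofReal_mul (by positivity)]
          exact ENNReal.ofReal_le_ofReal (mul_le_mul_of_nonneg_right hk2 (hv0 s))
      _ = ∑' k : ℕ, ∫⁻ s, ENNReal.ofReal (4 * (1 / 4) ^ k / δ) *
            (Metric.closedBall t (2 ^ k * δ)).indicator (fun s => ENNReal.ofReal (v s)) s ∂m := by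
          refine lintegral_tsum fun k => ?_
          exact ((hv.aemeasurable.ennreal_ofReal).indicator
            Metric.isClosed_closedBall.measurableSet).const_mul _
      _ = _ := by
          refine tsum_congr fun k => ?_
          rw [lintegral_const_mul' _ _ ENNReal.ofReal_ne_top,
            lintegral_indicator Metric.isClosed_closedBall.measurableSet,
            ← ofReal_integral_eq_lintegral_ofReal hv.integrableOn (Eventually.of_forall hv0),
            ENNReal.ofReal_mul (by positivity)]

/-! ### The Herglotz and Poisson kernels -/

theorem fourier_eq_z_zpow (n : ℤ) (t : Circ) : fourier n t = z t ^ n := by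
  rw [fourier_apply, toCircle_zsmul, Circle.coe_zpow]; rfl

theorem conj_z_pow (n : ℕ) (t : Circ) : conj (z t) ^ n = fourier (-(n : ℤ)) t := by
  rw [fourier_neg, fourier_eq_z_zpow, zpow_natCast, map_pow]

theorem fourierCoeff_eq_integral_mul (k : Circ → ℂ) (n : ℤ) :
    fourierCoeff k n = ∫ s, fourier (-n) s * k s ∂m := rfl

theorem fourierCoeff_zero_eq (k : Circ → ℂ) : fourierCoeff k 0 = ∫ s, k s ∂m := by
  rw [fourierCoeff_eq_integral_mul]
  simp

/-- The Herglotz kernel `(ζ + a) / (ζ - a)`, whose real part is the Poisson kernel. -/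
def herglotz (a : ℂ) (s : Circ) : ℂ := (z s + a) / (z s - a)

theorem z_sub_ne_zero {a : ℂ} (ha : ‖a‖ < 1) (s : Circ) : z s - a ≠ 0 := by
  intro h
  rw [sub_eq_zero] at h
  rw [← h, norm_z] at ha
  exact lt_irrefl _ ha

theorem norm_a_conj_z (a : ℂ) (s : Circ) : ‖a * conj (z s)‖ = ‖a‖ := by
  rw [norm_mul, RCLike.norm_conj, norm_z, mul_one]

theorem one_sub_ne_zero_of_norm {q : ℂ} (hq : ‖q‖ < 1) : 1 - q ≠ 0 := by
  intro h
  rw [sub_eq_zero] at h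
  rw [← h, norm_one] at hq
  exact lt_irrefl _ hq

/-- The Herglotz kernel in terms of the Cauchy kernel. -/
theorem herglotz_eq {a : ℂ} (ha : ‖a‖ < 1) (s : Circ) :
    herglotz a s = 2 * (1 - a * conj (z s))⁻¹ - 1 := by
  have h1 : 1 - a * conj (z s) ≠ 0 := one_sub_ne_zero_of_norm (by rwa [norm_a_conj_z])
  have h2 := z_sub_ne_zero ha s
  have h3 := conj_z_mul_z s
  have h4 : z s - a = z s * (1 - a * conj (z s)) := by linear_combination a * h3
  have h5 := z_ne_zero s
  rw [herglotz, h4]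
  field_simp
  linear_combination -a * h3

theorem herglotz_re {a : ℂ} (s : Circ) :
    (herglotz a s).re = (1 - ‖a‖ ^ 2) / ‖z s - a‖ ^ 2 := by
  rw [herglotz, Complex.div_re, ← add_div, Complex.normSq_eq_norm_sq]
  congr 1
  have h : ‖z s‖ ^ 2 = 1 := by rw [norm_z]; norm_num
  rw [← Complex.normSq_eq_norm_sq, Complex.normSq_apply] at h ⊢
  simp only [Complex.add_re, Complex.add_im, Complex.sub_re, Complex.sub_im]
  linarith

theorem herglotz_re_nonneg {a : ℂ} (ha : ‖a‖ < 1) (s : Circ) : 0 ≤ (herglotz a s).re := by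
  rw [herglotz_re]
  have : ‖a‖ ^ 2 ≤ 1 := pow_le_one₀ (norm_nonneg _) ha.le
  exact div_nonneg (by linarith) (by positivity)

theorem continuous_herglotz {a : ℂ} (ha : ‖a‖ < 1) : Continuous (herglotz a) :=
  (continuous_z.add continuous_const).div (continuous_z.sub continuous_const) (z_sub_ne_zero ha)

theorem integrable_continuous_mul {q k : Circ → ℂ} (hq : Continuous q) (hk : Integrable k m) :
    Integrable (fun s => q s * k s) m := by
  obtain ⟨C, hC⟩ := isCompact_univ.exists_bound_of_continuousOn hq.continuousOn
  exact hk.bdd_mul hq.aestronglyMeasurable (Eventually.of_forall fun s => hC s (Set.mem_univ s))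

theorem integrable_herglotz_mul {a : ℂ} (ha : ‖a‖ < 1) {k : Circ → ℂ} (hk : Integrable k m) :
    Integrable (fun s => herglotz a s * k s) m :=
  integrable_continuous_mul (continuous_herglotz ha) hk

theorem integrable_poisson_mul {a : ℂ} (ha : ‖a‖ < 1) {k : Circ → ℂ} (hk : Integrable k m) :
    Integrable (fun s => ((herglotz a s).re : ℂ) * k s) m :=
  integrable_continuous_mul
    (Complex.continuous_ofReal.comp (Complex.continuous_re.comp (continuous_herglotz ha))) hk

/-- Termwise integration of a geometric series against an integrable function. -/
theorem hasSum_integral_geometric {k q : Circ → ℂ} (hk : Integrable k m) (hq : Continuous q)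
    {ρ : ℝ} (hρ : ρ < 1) (hqρ : ∀ s, ‖q s‖ ≤ ρ) :
    HasSum (fun n : ℕ => ∫ s, q s ^ n * k s ∂m) (∫ s, (1 - q s)⁻¹ * k s ∂m) := by
  have hρ0 : 0 ≤ ρ := (norm_nonneg _).trans (hqρ 0)
  have h1 : ∀ n : ℕ, Integrable (fun s => q s ^ n * k s) m := fun n =>
    integrable_continuous_mul (hq.pow n) hk
  have h2 : Summable fun n : ℕ => ∫ s, ‖q s ^ n * k s‖ ∂m := by
    refine Summable.of_nonneg_of_le (fun n => integral_nonneg fun s => norm_nonneg _) (fun n => ?_)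
      ((summable_geometric_of_lt_one hρ0 hρ).mul_right (∫ s, ‖k s‖ ∂m))
    rw [← integral_const_mul]
    refine integral_mono (h1 n).norm (hk.norm.const_mul _) fun s => ?_
    simp only [norm_mul, norm_pow]
    have := hqρ s
    gcongr
  have h3 := hasSum_integral_of_summable_integral_norm h1 h2
  have h4 : (fun s => (1 - q s)⁻¹ * k s) = fun s => ∑' n : ℕ, q s ^ n * k s := by
    ext s
    rw [tsum_mul_right, tsum_geometric_of_norm_lt_one ((hqρ s).trans_lt hρ)]
  rwa [h4]

/-- The Cauchy integral of `k ∈ L¹` as the power series of its Fourier coefficients. -/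
theorem hasSum_cauchy {k : Circ → ℂ} (hk : Integrable k m) {a : ℂ} (ha : ‖a‖ < 1) :
    HasSum (fun n : ℕ => a ^ n * fourierCoeff k n) (∫ s, (1 - a * conj (z s))⁻¹ * k s ∂m) := by
  have h := hasSum_integral_geometric hk (q := fun s => a * conj (z s))
    (continuous_const.mul (Complex.continuous_conj.comp continuous_z)) ha
    (fun s => (norm_a_conj_z a s).le)
  convert h using 2 with n
  rw [fourierCoeff_eq_integral_mul, ← integral_const_mul]
  refine integral_congr_ae (Eventually.of_forall fun s => ?_)
  simp only
  rw [mul_pow, conj_z_pow, mul_assoc]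

theorem hasSum_conj_cauchy {k : Circ → ℂ} (hk : Integrable k m) {a : ℂ} (ha : ‖a‖ < 1) :
    HasSum (fun n : ℕ => conj a ^ n * fourierCoeff k (-n))
      (∫ s, (1 - conj a * z s)⁻¹ * k s ∂m) := by
  have h := hasSum_integral_geometric hk (q := fun s => conj a * z s)
    (continuous_const.mul continuous_z) ha
    (fun s => (by rw [norm_mul, RCLike.norm_conj, norm_z, mul_one] : ‖conj a * z s‖ ≤ ‖a‖))
  convert h using 2 with n
  rw [fourierCoeff_eq_integral_mul, ← integral_const_mul]
  refine integral_congr_ae (Eventually.of_forall fun s => ?_)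
  simp only
  rw [mul_pow, neg_neg, fourier_eq_z_zpow, zpow_natCast, mul_assoc]

theorem integrable_inv_mul {k : Circ → ℂ} (hk : Integrable k m) {a : ℂ} (ha : ‖a‖ < 1) :
    Integrable (fun s => (1 - a * conj (z s))⁻¹ * k s) m :=
  integrable_continuous_mul (q := fun s => (1 - a * conj (z s))⁻¹)
    (Continuous.inv₀ (continuous_const.sub (continuous_const.mul
      (Complex.continuous_conj.comp continuous_z)))
      fun s => one_sub_ne_zero_of_norm ((norm_a_conj_z a s).trans_lt ha)) hk

theorem integrable_conj_inv_mul {k : Circ → ℂ} (hk : Integrable k m) {a : ℂ} (ha : ‖a‖ < 1) :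
    Integrable (fun s => (1 - conj a * z s)⁻¹ * k s) m :=
  integrable_continuous_mul (q := fun s => (1 - conj a * z s)⁻¹)
    (Continuous.inv₀ (continuous_const.sub (continuous_const.mul continuous_z))
      fun s => one_sub_ne_zero_of_norm (q := conj a * z s)
        (by rwa [norm_mul, RCLike.norm_conj, norm_z, mul_one])) hk

theorem hasSum_herglotz {k : Circ → ℂ} (hk : Integrable k m) {a : ℂ} (ha : ‖a‖ < 1) :
    HasSum (fun n : ℕ => 2 * (a ^ n * fourierCoeff k n))
      ((∫ s, herglotz a s * k s ∂m) + fourierCoeff k 0) := by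
  have h := (hasSum_cauchy hk ha).mul_left 2
  suffices e : (∫ s, herglotz a s * k s ∂m) + fourierCoeff k 0 =
      2 * ∫ s, (1 - a * conj (z s))⁻¹ * k s ∂m by rwa [e]
  rw [fourierCoeff_zero_eq, ← integral_add (integrable_herglotz_mul ha hk) hk,
    ← integral_const_mul]
  refine integral_congr_ae (Eventually.of_forall fun s => ?_)
  simp only
  rw [herglotz_eq ha]; ring

/-- The Poisson integral of `k ∈ L¹` in terms of its Fourier coefficients. -/
theorem poisson_eq_tsum {k : Circ → ℂ} (hk : Integrable k m) {a : ℂ} (ha : ‖a‖ < 1) :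
    ∫ s, ((herglotz a s).re : ℂ) * k s ∂m = (∑' n : ℕ, a ^ n * fourierCoeff k n) +
      (∑' n : ℕ, conj a ^ n * fourierCoeff k (-n)) - fourierCoeff k 0 := by
  rw [(hasSum_cauchy hk ha).tsum_eq, (hasSum_conj_cauchy hk ha).tsum_eq, fourierCoeff_zero_eq,
    ← integral_add (integrable_inv_mul hk ha) (integrable_conj_inv_mul hk ha),
    ← integral_sub (f := fun s => (1 - a * conj (z s))⁻¹ * k s + (1 - conj a * z s)⁻¹ * k s)
      ((integrable_inv_mul hk ha).add (integrable_conj_inv_mul hk ha)) hk]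
  refine integral_congr_ae (Eventually.of_forall fun s => ?_)
  simp only
  rw [Complex.re_eq_add_conj, herglotz_eq ha]
  simp only [map_sub, map_mul, map_inv₀, map_one, Complex.conj_conj, map_ofNat]
  ring

theorem tsum_eq_zeroth {c : ℕ → ℂ} {b : ℂ} (hc : ∀ n, n ≠ 0 → c n = 0) :
    ∑' n : ℕ, b ^ n * c n = c 0 := by
  rw [tsum_eq_single 0 fun n hn => by rw [hc n hn, mul_zero]]
  simp

/-- The Poisson integral of a function with vanishing negative Fourier coefficients is the power
series with its Fourier coefficients. -/
theorem poisson_of_analytic {k : Circ → ℂ} (hk : Integrable k m)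
    (hneg : ∀ n : ℤ, n < 0 → fourierCoeff k n = 0) {a : ℂ} (ha : ‖a‖ < 1) :
    ∫ s, ((herglotz a s).re : ℂ) * k s ∂m = ∑' n : ℕ, a ^ n * fourierCoeff k n := by
  rw [poisson_eq_tsum hk ha,
    tsum_eq_zeroth (c := fun n : ℕ => fourierCoeff k (-(n : ℤ))) fun n hn => hneg _ (by omega)]
  simp

theorem fourierCoeff_const (c : ℂ) {n : ℤ} (hn : n ≠ 0) :
    fourierCoeff (fun _ : Circ => c) n = 0 := by
  have h : (fun _ : Circ => c) = fun t => c * (fourier 0 t : ℂ) := by ext t; simp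
  rw [h, fourierCoeff.const_mul, fourierCoeff_fourier, Pi.single_apply, if_neg hn, mul_zero]

theorem integral_poisson {a : ℂ} (ha : ‖a‖ < 1) (c : ℂ) :
    ∫ s, ((herglotz a s).re : ℂ) * c ∂m = c := by
  rw [poisson_of_analytic (integrable_const c) (fun n hn => fourierCoeff_const c hn.ne) ha,
    tsum_eq_zeroth (c := fun n : ℕ => fourierCoeff (fun _ : Circ => c) n)
      fun n hn => fourierCoeff_const c (by exact_mod_cast hn)]
  simp [fourierCoeff_zero_eq]

/-! ### Radial limits of Poisson integrals -/

theorem norm_real_mul_z {r : ℝ} (hr : 0 ≤ r) (t : Circ) : ‖(r : ℂ) * z t‖ = r := by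
  rw [norm_mul, norm_z, mul_one, Complex.norm_real, Real.norm_of_nonneg hr]

/-- Fatou's theorem: the Poisson integral of `u ∈ L¹` has radial limit `u` almost everywhere,
namely at every Lebesgue point of `u`. -/
theorem ae_tendsto_poisson {u : Circ → ℂ} (hu : Integrable u m) :
    ∀ᵐ t ∂m, Tendsto (fun r : ℝ => ∫ s, ((herglotz ((r : ℂ) * z t) s).re : ℂ) * u s ∂m)
      (𝓝[<] 1) (𝓝 (u t)) := by
  have hl := IsUnifLocDoublingMeasure.ae_tendsto_average_norm_sub (μ := (volume : Measure Circ))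
    (f := u) (by rw [volume_eq_m]; exact hu.locallyIntegrable) 1
  rw [volume_eq_m] at hl
  filter_upwards [hl] with t ht
  have h1 := ht (l := 𝓝[>] (0 : ℝ)) (fun _ => t) id tendsto_id (by
    filter_upwards [self_mem_nhdsWithin] with δ hδ
    have : (0 : ℝ) < δ := hδ
    simpa using this.le)
  have hv : Integrable (fun s => ‖u s - u t‖) m := (hu.sub (integrable_const _)).norm
  have h2 := (tendsto_integral_kernel hv (fun s => norm_nonneg _) h1).const_mul 2
  rw [mul_zero] at h2
  have h3 : Tendsto (fun r : ℝ => 1 - r) (𝓝[<] 1) (𝓝[>] 0) := by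
    refine tendsto_nhdsWithin_iff.2 ⟨?_, ?_⟩
    · have : Tendsto (fun r : ℝ => 1 - r) (𝓝 1) (𝓝 (1 - 1)) := tendsto_const_nhds.sub tendsto_id
      rw [sub_self] at this
      exact this.mono_left nhdsWithin_le_nhds
    · filter_upwards [self_mem_nhdsWithin] with r hr using sub_pos.2 (Set.mem_Iio.1 hr)
  rw [tendsto_iff_norm_sub_tendsto_zero]
  refine squeeze_zero' (Eventually.of_forall fun r => norm_nonneg _) ?_ (h2.comp h3)
  filter_upwards [Ioo_mem_nhdsLT (by norm_num : (1 / 2 : ℝ) < 1)] with r hr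
  have hr0 : 0 ≤ r := by linarith [hr.1]
  have ha : ‖(r : ℂ) * z t‖ < 1 := by rw [norm_real_mul_z hr0]; exact hr.2
  have hdiff : (∫ s, ((herglotz ((r : ℂ) * z t) s).re : ℂ) * u s ∂m) - u t =
      ∫ s, ((herglotz ((r : ℂ) * z t) s).re : ℂ) * (u s - u t) ∂m := by
    simp_rw [mul_sub]
    rw [integral_sub (integrable_poisson_mul ha hu)
      (integrable_poisson_mul ha (integrable_const _)), integral_poisson ha]
  rw [hdiff]
  refine (norm_integral_le_integral_norm _).trans ?_
  simp only [Function.comp]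
  rw [← integral_const_mul]
  have hδ : 0 < 1 - r := by linarith [hr.2]
  have hb : ∀ s, (herglotz ((r : ℂ) * z t) s).re ≤
      2 * ((1 - r) / ((1 - r) ^ 2 + dist s t ^ 2)) := by
    intro s
    have hlow := norm_z_sub_sq_lower hr.1.le s t
    rw [herglotz_re, norm_real_mul_z hr0, ← mul_div_assoc]
    have : 1 - r ^ 2 ≤ 2 * (1 - r) := by nlinarith
    exact div_le_div₀ (by positivity) this (by positivity) hlow
  refine integral_mono_of_nonneg (Eventually.of_forall fun s => norm_nonneg _) ?_
    (Eventually.of_forall fun s => ?_)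
  · refine Integrable.const_mul ?_ 2
    refine hv.bdd_mul (c := 1 / (1 - r)) (Continuous.aestronglyMeasurable ?_)
      (Eventually.of_forall fun s => ?_)
    · exact continuous_const.div (by fun_prop) fun s => by positivity
    · rw [Real.norm_of_nonneg (by positivity), div_le_div_iff₀ (by positivity) hδ]
      nlinarith [sq_nonneg (dist s t)]
  · simp only
    rw [norm_mul, Complex.norm_real, Real.norm_of_nonneg (herglotz_re_nonneg ha s),
      ← mul_assoc]
    exact mul_le_mul_of_nonneg_right (hb s) (norm_nonneg _)

/-- Uniqueness of Fourier coefficients in `L¹`. -/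
theorem ae_eq_zero_of_fourierCoeff {k : Circ → ℂ} (hk : Integrable k m)
    (h : ∀ n, fourierCoeff k n = 0) : k =ᵐ[m] 0 := by
  filter_upwards [ae_tendsto_poisson hk] with t ht
  refine tendsto_nhds_unique ht (tendsto_const_nhds.congr' ?_)
  filter_upwards [Ioo_mem_nhdsLT (by norm_num : (1 / 2 : ℝ) < 1)] with r hr
  have hr0 : 0 ≤ r := by linarith [hr.1]
  rw [poisson_eq_tsum hk (by rw [norm_real_mul_z hr0]; exact hr.2)]
  simp [h]

/-! ### Outer functions and their boundary values -/

variable {u v : Circ → ℝ} {F : Circ → ℂ} {φ : Lp ℂ ∞ m} {g : Lp ℝ 1 m}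

/-- The Herglotz integral of `u`: the analytic function on the disk whose real part is the Poisson
integral of `u` and whose imaginary part is the conjugate Poisson integral of `u`. -/
def herglotzInt (u : Circ → ℝ) (a : ℂ) : ℂ := ∫ s, herglotz a s * (u s : ℂ) ∂m

/-- The outer function in the disk with boundary modulus `exp u`. -/
def outerExt (u : Circ → ℝ) (a : ℂ) : ℂ := Complex.exp (herglotzInt u a)

/-- The outer function on the circle with modulus `exp u`. -/
def outerBdry (u : Circ → ℝ) (t : Circ) : ℂ :=
  Complex.exp ((u t : ℂ) + Complex.I * (harmonicConj u t : ℂ))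

theorem norm_outerBdry (u : Circ → ℝ) (t : Circ) : ‖outerBdry u t‖ = Real.exp (u t) := by
  simp [outerBdry, Complex.norm_exp]

theorem herglotzInt_im (hu : Integrable u m) {a : ℂ} (ha : ‖a‖ < 1) :
    (herglotzInt u a).im = conjPoisson u a := by
  have h := integral_im (𝕜 := ℂ) (integrable_herglotz_mul ha hu.ofReal)
  rw [herglotzInt, conjPoisson]
  refine h.symm.trans (integral_congr_ae (Eventually.of_forall fun s => ?_))
  simp [herglotz]

theorem herglotzInt_re (hu : Integrable u m) {a : ℂ} (ha : ‖a‖ < 1) :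
    (herglotzInt u a).re = ∫ s, (herglotz a s).re * u s ∂m := by
  have h := integral_re (𝕜 := ℂ) (integrable_herglotz_mul ha hu.ofReal)
  rw [herglotzInt]
  refine h.symm.trans (integral_congr_ae (Eventually.of_forall fun s => ?_))
  simp

theorem herglotzInt_re_eq_poisson (hu : Integrable u m) {a : ℂ} (ha : ‖a‖ < 1) :
    ((herglotzInt u a).re : ℂ) = ∫ s, ((herglotz a s).re : ℂ) * (u s : ℂ) ∂m := by
  rw [herglotzInt_re hu ha, ← integral_complex_ofReal]
  simp

theorem herglotzInt_zero_right (u : Circ → ℝ) : herglotzInt u 0 = ((∫ s, u s ∂m : ℝ) : ℂ) := by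
  rw [herglotzInt, ← integral_complex_ofReal]
  refine integral_congr_ae (Eventually.of_forall fun s => ?_)
  simp [herglotz, z_ne_zero]

theorem norm_outerExt (u : Circ → ℝ) (a : ℂ) :
    ‖outerExt u a‖ = Real.exp (herglotzInt u a).re := Complex.norm_exp _

theorem norm_outerExt_le (hu : Integrable u m) {C : ℝ} (hC : ∀ t, u t ≤ C) {a : ℂ}
    (ha : ‖a‖ < 1) : ‖outerExt u a‖ ≤ Real.exp C := by
  rw [norm_outerExt, Real.exp_le_exp, herglotzInt_re hu ha]
  have h1 : ∫ s, (herglotz a s).re * C ∂m = C := by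
    have := integral_poisson ha (C : ℂ)
    rw [← Complex.ofReal_inj, ← integral_complex_ofReal]
    simpa using this
  have hi : ∀ {w : Circ → ℝ}, Integrable w m →
      Integrable (fun s => (herglotz a s).re * w s) m := by
    intro w hw
    have := (integrable_poisson_mul ha hw.ofReal).re
    simpa using this
  rw [← h1]
  exact integral_mono (hi hu) (hi (integrable_const C)) fun s =>
    mul_le_mul_of_nonneg_left (hC s) (herglotz_re_nonneg ha s)

theorem outerExt_add (hu : Integrable u m) (hv : Integrable v m) {a : ℂ} (ha : ‖a‖ < 1) :
    outerExt (fun t => u t + v t) a = outerExt u a * outerExt v a := by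
  rw [outerExt, outerExt, outerExt, ← Complex.exp_add]
  congr 1
  rw [herglotzInt, herglotzInt, herglotzInt]
  refine Eq.trans ?_ (integral_add (integrable_herglotz_mul ha hu.ofReal)
    (integrable_herglotz_mul ha hv.ofReal))
  refine integral_congr_ae (Eventually.of_forall fun s => ?_)
  simp [mul_add]

theorem norm_fourier_apply (n : ℤ) (s : Circ) : ‖(fourier n s : ℂ)‖ = 1 := Circle.norm_coe _

theorem norm_fourierCoeff_le (k : Circ → ℂ) (n : ℤ) : ‖fourierCoeff k n‖ ≤ ∫ s, ‖k s‖ ∂m := by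
  rw [fourierCoeff_eq_integral_mul]
  refine (norm_integral_le_integral_norm _).trans (le_of_eq ?_)
  refine integral_congr_ae (Eventually.of_forall fun s => ?_)
  simp only [norm_mul, norm_fourier_apply, one_mul]

/-- The Herglotz integral is the sum of a power series in the disk, by `hasSum_herglotz`. -/
theorem differentiableOn_herglotzInt (hu : Integrable u m) :
    DifferentiableOn ℂ (herglotzInt u) (Metric.ball 0 1) := by
  intro a ha
  rw [mem_ball_zero_iff] at ha
  obtain ⟨ρ, h1, h2⟩ := exists_between ha
  have hρ0 : 0 ≤ ρ := (norm_nonneg a).trans h1.le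
  have hd : DifferentiableOn ℂ
      (fun b => ∑' n : ℕ, 2 * (b ^ n * fourierCoeff (fun s => (u s : ℂ)) n)) (Metric.ball 0 ρ) := by
    refine Complex.differentiableOn_tsum_of_summable_norm
      (u := fun n : ℕ => 2 * (ρ ^ n * ∫ s, ‖(u s : ℂ)‖ ∂m))
      (((summable_geometric_of_lt_one hρ0 h2).mul_right _).mul_left 2) (fun n => by fun_prop)
      Metric.isOpen_ball fun n b hb => ?_
    rw [mem_ball_zero_iff] at hb
    rw [norm_mul, norm_mul, norm_pow, Complex.norm_ofNat]
    have := norm_fourierCoeff_le (fun s => (u s : ℂ)) n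
    gcongr
  have hd2 := (hd.sub_const (fourierCoeff (fun s => (u s : ℂ)) 0)).congr (f₁ := herglotzInt u)
    fun b hb => by
      rw [mem_ball_zero_iff] at hb
      have h := (hasSum_herglotz (hu.ofReal (𝕜 := ℂ)) (hb.trans h2)).tsum_eq
      exact eq_sub_of_add_eq h.symm
  exact (hd2.differentiableAt
    (Metric.isOpen_ball.mem_nhds (mem_ball_zero_iff.2 h1))).differentiableWithinAt

theorem differentiableOn_outerExt (hu : Integrable u m) :
    DifferentiableOn ℂ (outerExt u) (Metric.ball 0 1) :=
  (differentiableOn_herglotzInt hu).cexp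

/-- The Taylor coefficients at `0` of the outer function with boundary modulus `exp u`. -/
def outerCoeff (u : Circ → ℝ) (n : ℕ) : ℂ := (n.factorial : ℂ)⁻¹ * iteratedDeriv n (outerExt u) 0

theorem outerCoeff_zero (u : Circ → ℝ) : outerCoeff u 0 = (Real.exp (∫ s, u s ∂m) : ℂ) := by
  simp [outerCoeff, outerExt, herglotzInt_zero_right]

theorem hasSum_outerCoeff (hu : Integrable u m) {a : ℂ} (ha : ‖a‖ < 1) :
    HasSum (fun n => outerCoeff u n * a ^ n) (outerExt u a) := by
  have h := Complex.hasSum_taylorSeries_on_ball (differentiableOn_outerExt hu)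
    (mem_ball_zero_iff.2 ha)
  refine h.congr_fun fun n => ?_
  simp only [outerCoeff, sub_zero, smul_eq_mul]
  ring

theorem continuous_outerExt_circle (hu : Integrable u m) {r : ℝ} (hr0 : 0 ≤ r) (hr : r < 1) :
    Continuous fun t => outerExt u ((r : ℂ) * z t) :=
  (differentiableOn_outerExt hu).continuousOn.comp_continuous
    (continuous_const.mul continuous_z)
    fun t => by rw [mem_ball_zero_iff, norm_real_mul_z hr0]; exact hr

/-- The Fourier coefficients of the product of a dilated outer function with `F ∈ L¹`. -/
theorem hasSum_fourierCoeff_outerExt_mul (hu : Integrable u m) {r : ℝ} (hr0 : 0 ≤ r) (hr : r < 1)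
    {F : Circ → ℂ} (hF : Integrable F m) (n : ℤ) :
    HasSum (fun j : ℕ => outerCoeff u j * (r : ℂ) ^ j * fourierCoeff F (n - j))
      (fourierCoeff (fun t => outerExt u ((r : ℂ) * z t) * F t) n) := by
  have hsum : Summable fun j : ℕ => ‖outerCoeff u j * (r : ℂ) ^ j‖ :=
    (hasSum_outerCoeff hu (a := r)
      (by rwa [Complex.norm_real, Real.norm_of_nonneg hr0])).summable.norm
  have e : ∀ (j : ℕ) (s : Circ), outerCoeff u j * (r : ℂ) ^ j * (fourier (-(n - j)) s * F s) =
      fourier (-n) s * (outerCoeff u j * ((r : ℂ) * z s) ^ j * F s) := by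
    intro j s
    have : (fourier (-(n - j)) s : ℂ) = fourier (-n) s * z s ^ j := by
      rw [neg_sub, sub_eq_add_neg, add_comm, fourier_add, fourier_eq_z_zpow (j : ℤ), zpow_natCast]
    rw [this]; ring
  have h1 : ∀ j : ℕ, Integrable (fun s => outerCoeff u j * (r : ℂ) ^ j *
      (fourier (-(n - j)) s * F s)) m := fun j =>
    (integrable_continuous_mul (fourier _).continuous hF).const_mul _
  have h2 : Summable fun j : ℕ => ∫ s, ‖outerCoeff u j * (r : ℂ) ^ j *
      (fourier (-(n - j)) s * F s)‖ ∂m := by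
    refine (summable_congr fun j => ?_).1 (hsum.mul_right (∫ s, ‖F s‖ ∂m))
    rw [← integral_const_mul]
    refine integral_congr_ae (Eventually.of_forall fun s => ?_)
    simp only [norm_mul, norm_fourier_apply, one_mul]
  have h3 := hasSum_integral_of_summable_integral_norm h1 h2
  have h4 : fourierCoeff (fun t => outerExt u ((r : ℂ) * z t) * F t) n =
      ∫ s, ∑' j : ℕ, outerCoeff u j * (r : ℂ) ^ j * (fourier (-(n - j)) s * F s) ∂m := by
    refine integral_congr_ae (Eventually.of_forall fun s => ?_)
    simp only [e, smul_eq_mul]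
    rw [tsum_mul_left, tsum_mul_right,
      (hasSum_outerCoeff hu (by rw [norm_real_mul_z hr0]; exact hr)).tsum_eq]
  rw [h4]
  refine h3.congr_fun fun j => ?_
  rw [fourierCoeff_eq_integral_mul, integral_const_mul]

theorem fourierCoeff_outerExt (hu : Integrable u m) {r : ℝ} (hr0 : 0 ≤ r) (hr : r < 1) (n : ℕ) :
    fourierCoeff (fun t => outerExt u ((r : ℂ) * z t)) n = outerCoeff u n * (r : ℂ) ^ n := by
  have h := hasSum_fourierCoeff_outerExt_mul hu hr0 hr (integrable_const (1 : ℂ)) n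
  simp only [mul_one] at h
  rw [← h.tsum_eq, tsum_eq_single n]
  · rw [sub_self, fourierCoeff_zero_eq]; simp
  · intro j hj
    rw [fourierCoeff_const 1 (by omega : (n : ℤ) - j ≠ 0),
      mul_zero]

/-- Parseval's identity on the circles of radius `r < 1` bounds the Taylor coefficients of a bounded
outer function in `ℓ²`. -/
theorem sum_norm_outerCoeff_sq_le (hu : Integrable u m) {C : ℝ} (hC : ∀ t, u t ≤ C) (N : ℕ) :
    ∑ n ∈ Finset.range N, ‖outerCoeff u n‖ ^ 2 ≤ Real.exp C ^ 2 := by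
  have key : ∀ r : ℝ, 0 ≤ r → r < 1 →
      ∑ n ∈ Finset.range N, (‖outerCoeff u n‖ * r ^ n) ^ 2 ≤ Real.exp C ^ 2 := by
    intro r hr0 hr
    have hb : ∀ t, ‖outerExt u ((r : ℂ) * z t)‖ ≤ Real.exp C := fun t =>
      norm_outerExt_le hu hC (by rw [norm_real_mul_z hr0]; exact hr)
    have hmem : MemLp (fun t => outerExt u ((r : ℂ) * z t)) 2 m :=
      MemLp.of_bound (continuous_outerExt_circle hu hr0 hr).aestronglyMeasurable _
        (Eventually.of_forall hb)
    have h := hasSum_sq_fourierCoeff (hmem.toLp _)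
    have h1 : ∀ n : ℕ, ‖fourierCoeff (hmem.toLp _) (n : ℤ)‖ ^ 2 =
        (‖outerCoeff u n‖ * r ^ n) ^ 2 := by
      intro n
      rw [fourierCoeff_congr_ae hmem.coeFn_toLp, fourierCoeff_outerExt hu hr0 hr, norm_mul,
        norm_pow, Complex.norm_real, Real.norm_of_nonneg hr0]
    have h2 : ∫ t, ‖hmem.toLp _ t‖ ^ 2 ∂m ≤ Real.exp C ^ 2 := by
      calc ∫ t, ‖hmem.toLp _ t‖ ^ 2 ∂m ≤ ∫ _, Real.exp C ^ 2 ∂m := by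
            refine integral_mono_of_nonneg (Eventually.of_forall fun t => by positivity)
              (integrable_const _) ?_
            filter_upwards [hmem.coeFn_toLp] with t ht
            rw [ht]
            exact pow_le_pow_left₀ (norm_nonneg _) (hb t) 2
        _ = _ := by simp
    refine le_trans ?_ h2
    have h3 := sum_le_hasSum ((Finset.range N).map ⟨fun n : ℕ => (n : ℤ), Nat.cast_injective⟩)
      (fun _ _ => by positivity) h
    rw [Finset.sum_map] at h3
    simpa only [Function.Embedding.coeFn_mk, h1] using h3
  have hlim : Tendsto (fun r : ℝ => ∑ n ∈ Finset.range N, (‖outerCoeff u n‖ * r ^ n) ^ 2) (𝓝[<] 1)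
      (𝓝 (∑ n ∈ Finset.range N, (‖outerCoeff u n‖ * 1 ^ n) ^ 2)) := by
    refine Tendsto.mono_left (Continuous.tendsto ?_ 1) nhdsWithin_le_nhds
    fun_prop
  simp only [one_pow, mul_one] at hlim
  refine le_of_tendsto hlim ?_
  filter_upwards [Ioo_mem_nhdsLT (by norm_num : (0 : ℝ) < 1)] with r hr using key r hr.1.le hr.2

/-- A bounded outer function has radial limits almost everywhere: its Taylor coefficients are square
summable, so that it is the Poisson integral of an `L²` function. -/
theorem ae_exists_tendsto_outerExt_of_le (hu : Integrable u m) {C : ℝ} (hC : ∀ t, u t ≤ C) :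
    ∀ᵐ t ∂m, ∃ L, Tendsto (fun r : ℝ => outerExt u ((r : ℂ) * z t)) (𝓝[<] 1) (𝓝 L) := by
  have hs : Summable fun n : ℕ => ‖outerCoeff u n‖ ^ 2 :=
    summable_of_sum_range_le (fun _ => by positivity) (sum_norm_outerCoeff_sq_le hu hC)
  set c : ℤ → ℂ := Function.extend (fun n : ℕ => (n : ℤ)) (outerCoeff u) 0 with hc
  have hcn : ∀ n : ℕ, c n = outerCoeff u n := fun n => Nat.cast_injective.extend_apply _ _ n
  have hc0 : ∀ n : ℤ, n < 0 → c n = 0 := fun n hn =>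
    Function.extend_apply' _ _ _ (by rintro ⟨j, rfl⟩; omega)
  have hmem : Memℓp c 2 := by
    refine memℓp_gen ?_
    have := (Function.Injective.summable_iff (g := fun n : ℕ => (n : ℤ))
      (f := fun n : ℤ => ‖c n‖ ^ 2) Nat.cast_injective (fun n hn => by
        rw [hc0 n (not_le.1 fun h => hn ⟨n.toNat, by simp [h]⟩)]; simp)).1
      (by simpa only [Function.comp_def, hcn] using hs)
    simpa using this
  set f : Lp ℂ 2 m := fourierBasis.repr.symm ⟨c, hmem⟩ with hf
  have hcoef : ∀ n, fourierCoeff f n = c n := by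
    intro n
    rw [← fourierBasis_repr, hf, LinearIsometryEquiv.apply_symm_apply]
  have hfi : Integrable f m := (Lp.memLp f).integrable (by norm_num)
  filter_upwards [ae_tendsto_poisson hfi] with t ht
  refine ⟨f t, ht.congr' ?_⟩
  filter_upwards [Ioo_mem_nhdsLT (by norm_num : (0 : ℝ) < 1)] with r hr
  have ha : ‖(r : ℂ) * z t‖ < 1 := by rw [norm_real_mul_z hr.1.le]; exact hr.2
  rw [poisson_of_analytic hfi (fun n hn => by rw [hcoef, hc0 n hn]) ha,
    ← (hasSum_outerCoeff hu ha).tsum_eq]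
  exact tsum_congr fun n => by rw [hcoef, hcn, mul_comm]

theorem ae_tendsto_herglotzInt_re (hu : Integrable u m) :
    ∀ᵐ t ∂m, Tendsto (fun r : ℝ => (herglotzInt u ((r : ℂ) * z t)).re) (𝓝[<] 1) (𝓝 (u t)) := by
  filter_upwards [ae_tendsto_poisson hu.ofReal] with t ht
  have h := (Complex.continuous_re.tendsto _).comp ht
  refine h.congr' ?_
  filter_upwards [Ioo_mem_nhdsLT (by norm_num : (0 : ℝ) < 1)] with r hr
  have ha : ‖(r : ℂ) * z t‖ < 1 := by rw [norm_real_mul_z hr.1.le]; exact hr.2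
  have := herglotzInt_re_eq_poisson hu ha
  simp only [Function.comp]
  exact (congrArg Complex.re this).symm.trans (Complex.ofReal_re _)

/-- Radial limits of outer functions exist almost everywhere: an outer function is the quotient of the
bounded outer functions with logarithmic moduli `min u 0` and `min (-u) 0`, and the limit of the
denominator does not vanish. -/
theorem ae_exists_tendsto_outerExt (hu : Integrable u m) :
    ∀ᵐ t ∂m, ∃ L, Tendsto (fun r : ℝ => outerExt u ((r : ℂ) * z t)) (𝓝[<] 1) (𝓝 L) := by
  have h1 : Integrable (fun t => min (u t) 0) m := hu.inf (integrable_zero _ _ _)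
  have h2 : Integrable (fun t => min (-u t) 0) m := hu.neg.inf (integrable_zero _ _ _)
  filter_upwards [ae_exists_tendsto_outerExt_of_le h1 (C := 0) (fun t => min_le_right _ _),
    ae_exists_tendsto_outerExt_of_le h2 (C := 0) (fun t => min_le_right _ _),
    ae_tendsto_herglotzInt_re h2] with t ⟨L₁, hL₁⟩ ⟨L₂, hL₂⟩ ht
  have hne : L₂ ≠ 0 := by
    have h3 := (Real.continuous_exp.tendsto _).comp ht
    have h4 : ‖L₂‖ = Real.exp (min (-u t) 0) := by
      refine tendsto_nhds_unique hL₂.norm (h3.congr fun r => ?_)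
      simp [norm_outerExt]
    rw [← norm_ne_zero_iff, h4]
    exact (Real.exp_pos _).ne'
  refine ⟨L₁ / L₂, (hL₁.div hL₂ hne).congr' ?_⟩
  filter_upwards [Ioo_mem_nhdsLT (by norm_num : (0 : ℝ) < 1)] with r hr
  have ha : ‖(r : ℂ) * z t‖ < 1 := by rw [norm_real_mul_z hr.1.le]; exact hr.2
  have e : (fun t => min (u t) 0) = fun t => u t + min (-u t) 0 := by
    ext t
    rcases le_total (u t) 0 with h | h
    · rw [min_eq_left h, min_eq_right (by linarith), add_zero]
    · rw [min_eq_right h, min_eq_left (by linarith)]; ring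
  have hne' : outerExt (fun t => min (-u t) 0) ((r : ℂ) * z t) ≠ 0 := Complex.exp_ne_zero _
  rw [Pi.div_apply, e, outerExt_add hu h2 ha, mul_div_cancel_right₀ _ hne']

/-- A continuous angle whose direction converges converges itself. -/
theorem exists_tendsto_of_tendsto_exp {θ : ℝ → ℝ} (hc : ContinuousOn θ (Set.Ico 0 1)) {L : ℂ}
    (hL : Tendsto (fun r => Complex.exp (θ r * Complex.I)) (𝓝[<] 1) (𝓝 L)) :
    ∃ x, Tendsto θ (𝓝[<] 1) (𝓝 x) := by
  -- Modulo `2π` the angle is `arg L` plus a quantity tending to `0`; the remaining integer multiple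
  -- of `2π` is continuous near `1`, hence constant.
  have hL1 : ‖L‖ = 1 := by
    refine tendsto_nhds_unique hL.norm (tendsto_const_nhds.congr fun r => ?_)
    rw [Complex.norm_exp_ofReal_mul_I]
  have hL0 : L ≠ 0 := by rw [← norm_ne_zero_iff, hL1]; norm_num
  have hLa : Complex.exp (L.arg * Complex.I) = L := by
    have := Complex.norm_mul_exp_arg_mul_I L
    rwa [hL1, Complex.ofReal_one, one_mul] at this
  set q : ℝ → ℂ := fun r => Complex.exp (θ r * Complex.I) / L with hq
  have hq1 : Tendsto q (𝓝[<] 1) (𝓝 1) := by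
    have := hL.div_const L
    rwa [div_self hL0] at this
  have hy : Tendsto (fun r => (q r).arg) (𝓝[<] 1) (𝓝 0) := by
    have := (Complex.continuousAt_arg Complex.one_mem_slitPlane).tendsto.comp hq1
    rwa [Complex.arg_one] at this
  have hev := hq1.eventually (Complex.isOpen_slitPlane.mem_nhds Complex.one_mem_slitPlane)
  obtain ⟨b, hb1, hb⟩ := (mem_nhdsLT_iff_exists_Ioo_subset).1 hev
  have hb1 : b < 1 := hb1
  set b' := max b 0 with hb'
  have hb'1 : b' < 1 := max_lt hb1 one_pos
  have hsub : Set.Ioo b' 1 ⊆ Set.Ico 0 1 := fun r hr =>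
    ⟨(le_max_right b 0).trans hr.1.le, hr.2⟩
  have hslit : ∀ r ∈ Set.Ioo b' 1, q r ∈ Complex.slitPlane := fun r hr =>
    hb ⟨(le_max_left b 0).trans_lt hr.1, hr.2⟩
  have hqc : ContinuousOn q (Set.Ioo b' 1) :=
    ((Complex.continuous_ofReal.comp_continuousOn (hc.mono hsub)).mul_const _).cexp.div_const L
  set D : ℝ → ℝ := fun r => (θ r - L.arg - (q r).arg) / (2 * Real.pi) with hD
  have hDc : ContinuousOn D (Set.Ioo b' 1) := by
    refine (((hc.mono hsub).sub continuousOn_const).sub ?_).div_const _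
    intro r hr
    exact (Complex.continuousAt_arg (hslit r hr)).comp_continuousWithinAt (hqc r hr)
  have hDint : Set.MapsTo D (Set.Ioo b' 1) (Set.range ((↑) : ℤ → ℝ)) := by
    intro r hr
    have hn : ‖q r‖ = 1 := by
      rw [hq]; simp only; rw [norm_div, Complex.norm_exp_ofReal_mul_I, hL1, div_one]
    have h1 : Complex.exp ((q r).arg * Complex.I) = q r := by
      have := Complex.norm_mul_exp_arg_mul_I (q r)
      rwa [hn, Complex.ofReal_one, one_mul] at this
    have h2 : Complex.exp ((θ r - L.arg - (q r).arg : ℝ) * Complex.I) = 1 := by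
      push_cast
      rw [sub_mul, sub_mul, Complex.exp_sub, Complex.exp_sub, h1, hLa]
      exact div_self (Complex.slitPlane_ne_zero (hslit r hr))
    obtain ⟨n, hn⟩ := Complex.exp_eq_one_iff.1 h2
    refine ⟨n, ?_⟩
    have h3 : ((θ r - L.arg - (q r).arg : ℝ) : ℂ) = ((n * (2 * Real.pi) : ℝ) : ℂ) := by
      apply mul_right_cancel₀ Complex.I_ne_zero
      rw [hn]; push_cast; ring
    rw [Complex.ofReal_inj] at h3
    rw [hD]; simp only; rw [h3]; field_simp
  have hdisc : IsDiscrete (Set.range ((↑) : ℤ → ℝ)) := isDiscrete_iff_discreteTopology.2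
    Int.isClosedEmbedding_coe_real.isEmbedding.toHomeomorph.symm.isEmbedding.discreteTopology
  obtain ⟨r₀, hr₀⟩ := Set.nonempty_Ioo.2 hb'1
  have hconst : ∀ r ∈ Set.Ioo b' 1, D r = D r₀ := fun r hr =>
    isPreconnected_Ioo.constant_of_mapsTo hdisc hDc hDint hr hr₀
  refine ⟨2 * Real.pi * D r₀ + L.arg + 0, (hy.const_add (2 * Real.pi * D r₀ + L.arg)).congr' ?_⟩
  filter_upwards [Ioo_mem_nhdsLT hb'1] with r hr
  rw [← hconst r hr, hD]
  field_simp
  ring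

/-- The conjugate Poisson integral of `u ∈ L¹` has radial limits almost everywhere, and the outer
function in the disk has the outer function on the circle as its radial limit. -/
theorem ae_tendsto_outerExt (hu : Integrable u m) :
    ∀ᵐ t ∂m, Tendsto (fun r : ℝ => outerExt u ((r : ℂ) * z t)) (𝓝[<] 1) (𝓝 (outerBdry u t)) := by
  filter_upwards [ae_exists_tendsto_outerExt hu, ae_tendsto_herglotzInt_re hu] with t ⟨L, hL⟩ ht
  have hre : Tendsto (fun r : ℝ => Complex.exp ((herglotzInt u ((r : ℂ) * z t)).re)) (𝓝[<] 1)
      (𝓝 (Complex.exp (u t))) :=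
    ((Complex.continuous_exp.comp Complex.continuous_ofReal).tendsto _).comp ht
  have hmap : ∀ r ∈ Set.Ico (0 : ℝ) 1, (r : ℂ) * z t ∈ Metric.ball (0 : ℂ) 1 := fun r hr => by
    rw [mem_ball_zero_iff, norm_real_mul_z hr.1]; exact hr.2
  have hcont : ContinuousOn (fun r : ℝ => (herglotzInt u ((r : ℂ) * z t)).im) (Set.Ico 0 1) :=
    Complex.continuous_im.comp_continuousOn ((differentiableOn_herglotzInt hu).continuousOn.comp
      (Complex.continuous_ofReal.mul continuous_const).continuousOn hmap)
  have him : Tendsto (fun r : ℝ => Complex.exp ((herglotzInt u ((r : ℂ) * z t)).im * Complex.I))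
      (𝓝[<] 1) (𝓝 (L / Complex.exp (u t))) := by
    refine (hL.div hre (Complex.exp_ne_zero _)).congr fun r => ?_
    rw [Pi.div_apply, outerExt]
    nth_rewrite 1 [← Complex.re_add_im (herglotzInt u ((r : ℂ) * z t))]
    rw [Complex.exp_add, mul_div_cancel_left₀ _ (Complex.exp_ne_zero _)]
  obtain ⟨x, hx⟩ := exists_tendsto_of_tendsto_exp hcont him
  have hconj : Tendsto (fun r : ℝ => conjPoisson u ((r : ℂ) * z t)) (𝓝[<] 1) (𝓝 x) := by
    refine hx.congr' ?_
    filter_upwards [Ioo_mem_nhdsLT (by norm_num : (0 : ℝ) < 1)] with r hr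
    exact herglotzInt_im hu (mem_ball_zero_iff.1 (hmap r ⟨hr.1.le, hr.2⟩))
  have hharm : harmonicConj u t = x := hconj.limUnder_eq
  rw [outerBdry, hharm]
  have h1 : Tendsto (fun r : ℝ => ((herglotzInt u ((r : ℂ) * z t)).re : ℂ) +
      Complex.I * ((herglotzInt u ((r : ℂ) * z t)).im : ℂ)) (𝓝[<] 1)
      (𝓝 ((u t : ℂ) + Complex.I * (x : ℂ))) :=
    ((Complex.continuous_ofReal.tendsto _).comp ht).add
      (((Complex.continuous_ofReal.tendsto _).comp hx).const_mul _)
  refine ((Complex.continuous_exp.tendsto _).comp h1).congr fun r => ?_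
  rw [Function.comp, outerExt]
  congr 1
  rw [mul_comm Complex.I, Complex.re_add_im]

/-! ### Multiplication by outer functions in Hardy spaces -/

theorem ae_tendsto_outerExt_seq (hu : Integrable u m) : ∀ᵐ t ∂m,
    Tendsto (fun n : ℕ => outerExt u (((1 - 1 / ((n : ℝ) + 1) : ℝ) : ℂ) * z t)) atTop
      (𝓝 (outerBdry u t)) := by
  filter_upwards [ae_tendsto_outerExt hu] with t ht
  refine ht.comp (tendsto_nhdsWithin_iff.2 ⟨?_, Eventually.of_forall fun n => ?_⟩)
  · have := (tendsto_one_div_add_atTop_nhds_zero_nat (𝕜 := ℝ)).const_sub 1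
    rwa [sub_zero] at this
  · have : 0 < 1 / ((n : ℝ) + 1) := by positivity
    simp only [Set.mem_Iio]; linarith

theorem one_sub_one_div_mem (n : ℕ) :
    0 ≤ 1 - 1 / ((n : ℝ) + 1) ∧ 1 - 1 / ((n : ℝ) + 1) < 1 := by
  have h1 : 0 < 1 / ((n : ℝ) + 1) := by positivity
  have h2 : 1 / ((n : ℝ) + 1) ≤ 1 := by
    rw [div_le_one (by positivity)]
    have : (0 : ℝ) ≤ n := Nat.cast_nonneg n
    linarith
  exact ⟨by linarith, by linarith⟩

theorem aestronglyMeasurable_outerBdry (hu : Integrable u m) :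
    AEStronglyMeasurable (outerBdry u) m :=
  aestronglyMeasurable_of_tendsto_ae atTop
    (fun n => (continuous_outerExt_circle hu (one_sub_one_div_mem n).1
      (one_sub_one_div_mem n).2).aestronglyMeasurable) (ae_tendsto_outerExt_seq hu)

theorem outerBdry_add (hu : Integrable u m) (hv : Integrable v m) :
    outerBdry (fun t => u t + v t) =ᵐ[m] fun t => outerBdry u t * outerBdry v t := by
  filter_upwards [ae_tendsto_outerExt_seq hu, ae_tendsto_outerExt_seq hv,
    ae_tendsto_outerExt_seq (hu.add hv)] with t h1 h2 h3
  refine tendsto_nhds_unique h3 ((h1.mul h2).congr fun n => ?_)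
  refine (outerExt_add hu hv ?_).symm
  rw [norm_real_mul_z (one_sub_one_div_mem n).1]
  exact (one_sub_one_div_mem n).2

theorem outerBdry_neg_mul (hu : Integrable u m) :
    ∀ᵐ t ∂m, outerBdry (fun t => -u t) t * outerBdry u t = 1 := by
  have h0 : outerBdry (fun _ => 0) =ᵐ[m] fun _ => 1 := by
    filter_upwards [ae_tendsto_outerExt_seq (integrable_zero Circ ℝ m)] with t ht
    refine tendsto_nhds_unique ht (tendsto_const_nhds.congr fun n => ?_)
    simp [outerExt, herglotzInt]
  have h := outerBdry_add hu.neg hu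
  simp only [Pi.neg_apply, neg_add_cancel] at h
  filter_upwards [h0, h] with t h1 h2
  rw [← h1, h2]; rfl

theorem MemHardy.integrable (hF : MemHardy 1 F) : Integrable F m := memLp_one_iff_integrable.1 hF.1

theorem MemHardy.congr {p : ℝ≥0∞} {G : Circ → ℂ} (hF : MemHardy p F) (h : F =ᵐ[m] G) :
    MemHardy p G :=
  ⟨hF.1.ae_eq h, fun n hn => by rw [← fourierCoeff_congr_ae h]; exact hF.2 n hn⟩

theorem MemHardy.const_mul {p : ℝ≥0∞} (hF : MemHardy p F) (c : ℂ) :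
    MemHardy p fun t => c * F t :=
  ⟨hF.1.const_mul c, fun n hn => by rw [fourierCoeff.const_mul, hF.2 n hn, mul_zero]⟩

theorem MemHardy.add {G : Circ → ℂ} (hF : MemHardy 1 F) (hG : MemHardy 1 G) :
    MemHardy 1 fun t => F t + G t :=
  ⟨hF.1.add hG.1, fun n hn => by
    have := fourierCoeff.add hF.integrable hG.integrable
    have e : fourierCoeff (fun t => F t + G t) n = fourierCoeff F n + fourierCoeff G n :=
      congrFun this n
    rw [e, hF.2 n hn, hG.2 n hn, add_zero]⟩

theorem memHardy_one_of_two (hF : MemHardy 2 F) : MemHardy 1 F :=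
  ⟨hF.1.mono_exponent (by norm_num), hF.2⟩

theorem memHardy_const (c : ℂ) : MemHardy 1 (fun _ => c) :=
  ⟨memLp_const c, fun _ hn => fourierCoeff_const c hn.ne⟩

theorem integrable_outerBdry_mul_of_le (hu : Integrable u m) {C : ℝ} (hC : ∀ t, u t ≤ C)
    (hF : Integrable F m) : Integrable (fun t => outerBdry u t * F t) m :=
  hF.bdd_mul (c := Real.exp C) (aestronglyMeasurable_outerBdry hu)
    (Eventually.of_forall fun t => by rw [norm_outerBdry]; exact Real.exp_le_exp.2 (hC t))

/-- Dominated convergence for Fourier coefficients. -/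
theorem tendsto_fourierCoeff {G : ℕ → Circ → ℂ} {G₀ : Circ → ℂ} {b : Circ → ℝ}
    (hG : ∀ k, AEStronglyMeasurable (G k) m) (hb : Integrable b m)
    (hle : ∀ k, ∀ᵐ t ∂m, ‖G k t‖ ≤ b t)
    (hlim : ∀ᵐ t ∂m, Tendsto (fun k => G k t) atTop (𝓝 (G₀ t))) (n : ℤ) :
    Tendsto (fun k => fourierCoeff (G k) n) atTop (𝓝 (fourierCoeff G₀ n)) := by
  refine tendsto_integral_of_dominated_convergence b
    (fun k => (fourier (-n)).continuous.aestronglyMeasurable.smul (hG k)) hb (fun k => ?_) ?_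
  · filter_upwards [hle k] with t ht
    rw [smul_eq_mul, norm_mul, norm_fourier_apply, one_mul]
    exact ht
  · filter_upwards [hlim] with t ht using ht.const_smul _

/-- Multiplication by a bounded outer function preserves `H¹`. -/
theorem outerBdry_mul_of_le (hu : Integrable u m) {C : ℝ} (hC : ∀ t, u t ≤ C)
    (hF : MemHardy 1 F) : MemHardy 1 (fun t => outerBdry u t * F t) ∧
      fourierCoeff (fun t => outerBdry u t * F t) 0 =
        (Real.exp (∫ t, u t ∂m) : ℂ) * fourierCoeff F 0 := by
  -- On circles of radius `r < 1` the outer function is an absolutely convergent power series, so that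
  -- the coefficients of the product can be read off; then `r` tends to `1`.
  have hlim : ∀ n : ℤ, Tendsto (fun k : ℕ => fourierCoeff
      (fun t => outerExt u (((1 - 1 / ((k : ℝ) + 1) : ℝ) : ℂ) * z t) * F t) n) atTop
      (𝓝 (fourierCoeff (fun t => outerBdry u t * F t) n)) := by
    intro n
    refine tendsto_fourierCoeff (b := fun t => Real.exp C * ‖F t‖) (fun k => ?_)
      (hF.integrable.norm.const_mul _) (fun k => Eventually.of_forall fun t => ?_) ?_ n
    · exact (continuous_outerExt_circle hu (one_sub_one_div_mem k).1
        (one_sub_one_div_mem k).2).aestronglyMeasurable.mul hF.integrable.aestronglyMeasurable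
    · rw [norm_mul]
      refine mul_le_mul_of_nonneg_right (norm_outerExt_le hu hC ?_) (norm_nonneg _)
      rw [norm_real_mul_z (one_sub_one_div_mem k).1]
      exact (one_sub_one_div_mem k).2
    · filter_upwards [ae_tendsto_outerExt_seq hu] with t ht using ht.mul_const _
  have hco : ∀ (k : ℕ) (n : ℤ), _ := fun k n => hasSum_fourierCoeff_outerExt_mul hu
    (one_sub_one_div_mem k).1 (one_sub_one_div_mem k).2 hF.integrable n
  refine ⟨⟨memLp_one_iff_integrable.2 (integrable_outerBdry_mul_of_le hu hC hF.integrable),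
    fun n hn => tendsto_nhds_unique (hlim n) (tendsto_const_nhds.congr fun k => ?_)⟩,
    tendsto_nhds_unique (hlim 0) (tendsto_const_nhds.congr fun k => ?_)⟩
  · have h0 : ∀ j : ℕ, fourierCoeff F (n - j) = 0 := fun j => hF.2 _ (by omega)
    rw [← (hco k n).tsum_eq]
    simp only [h0, mul_zero, tsum_zero]
  · rw [← (hco k 0).tsum_eq, tsum_eq_single 0, outerCoeff_zero]
    · simp
    · intro j hj
      rw [hF.2 _ (by omega), mul_zero]

/-- The outer functions with moduli `exp (-(u - n)⁺)` converge to `1` almost everywhere along a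
subsequence: in `L²` their distance to `1` is controlled by their value at the centre of the
disk. -/
theorem exists_subseq_tendsto_one (hu : Integrable u m) :
    ∃ ns : ℕ → ℕ, StrictMono ns ∧ ∀ᵐ t ∂m, Tendsto
      (fun k => outerBdry (fun t => -max (u t - (ns k : ℝ)) 0) t) atTop (𝓝 1) := by
  set w : ℕ → Circ → ℝ := fun n t => -max (u t - (n : ℝ)) 0 with hw
  have hwi : ∀ n, Integrable (w n) m := fun n =>
    ((hu.sub (integrable_const (n : ℝ))).sup (integrable_zero _ _ _)).neg
  have hw0 : ∀ n t, w n t ≤ 0 := fun n t => by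
    simp only [hw]; exact neg_nonpos.2 (le_max_right _ _)
  have hint : Tendsto (fun n => ∫ t, w n t ∂m) atTop (𝓝 0) := by
    have h := tendsto_integral_of_dominated_convergence (μ := m) (F := w) (f := fun _ => 0)
      (fun t => ‖u t‖) (fun n => (hwi n).aestronglyMeasurable) hu.norm
      (fun n => Eventually.of_forall fun t => ?_) (Eventually.of_forall fun t => ?_)
    · simpa using h
    · simp only [hw]
      rw [norm_neg, Real.norm_of_nonneg (le_max_right _ _)]
      refine max_le ?_ (norm_nonneg _)
      have : (0 : ℝ) ≤ n := Nat.cast_nonneg n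
      linarith [Real.le_norm_self (u t)]
    · refine tendsto_const_nhds.congr' ?_
      filter_upwards [eventually_ge_atTop ⌈u t⌉₊] with n hn
      have : u t ≤ n := (Nat.le_ceil _).trans (by exact_mod_cast hn)
      simp only [hw]
      rw [max_eq_right (by linarith), neg_zero]
  have hb1 : ∀ n t, ‖outerBdry (w n) t‖ ≤ 1 := fun n t => by
    rw [norm_outerBdry]; exact Real.exp_le_one_iff.2 (hw0 n t)
  have hbi : ∀ n, Integrable (outerBdry (w n)) m := fun n =>
    (integrable_const (1 : ℝ)).mono' (aestronglyMeasurable_outerBdry (hwi n))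
      (Eventually.of_forall (hb1 n))
  have hcenter : ∀ n, ∫ t, outerBdry (w n) t ∂m = (Real.exp (∫ t, w n t ∂m) : ℂ) := fun n => by
    have h := (outerBdry_mul_of_le (hwi n) (hw0 n) (memHardy_const 1)).2
    rw [fourierCoeff_zero_eq, fourierCoeff_zero_eq] at h
    simpa using h
  set d : ℕ → Circ → ℝ := fun n t => ‖outerBdry (w n) t - 1‖ ^ 2 with hd
  have hdm : ∀ n, AEStronglyMeasurable (d n) m := fun n =>
    ((aestronglyMeasurable_outerBdry (hwi n)).sub aestronglyMeasurable_const).norm.pow 2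
  have hdle : ∀ n t, d n t ≤ 2 - 2 * (outerBdry (w n) t).re := by
    intro n t
    have h1 : ‖outerBdry (w n) t‖ ^ 2 ≤ 1 := pow_le_one₀ (norm_nonneg _) (hb1 n t)
    simp only [hd]
    rw [← Complex.normSq_eq_norm_sq, Complex.normSq_apply] at h1 ⊢
    simp only [Complex.sub_re, Complex.sub_im, Complex.one_re, Complex.one_im]
    nlinarith
  have hrhs : ∀ n, Integrable (fun t => 2 - 2 * (outerBdry (w n) t).re) m := fun n =>
    (integrable_const _).sub ((hbi n).re.const_mul 2)
  have hdint : ∀ n, ∫ t, d n t ∂m ≤ 2 - 2 * Real.exp (∫ t, w n t ∂m) := by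
    intro n
    have h1 : ∫ t, (outerBdry (w n) t).re ∂m = Real.exp (∫ t, w n t ∂m) := by
      have := integral_re (𝕜 := ℂ) (hbi n)
      simp only [RCLike.re_to_complex] at this
      rw [this, hcenter]; exact Complex.ofReal_re _
    have h2 : ∫ t, (2 - 2 * (outerBdry (w n) t).re) ∂m = 2 - 2 * Real.exp (∫ t, w n t ∂m) := by
      refine (integral_sub (integrable_const _) ((hbi n).re.const_mul 2)).trans ?_
      rw [integral_const_mul]
      simp only [RCLike.re_to_complex, h1]
      simp
    rw [← h2]
    exact integral_mono_of_nonneg (Eventually.of_forall fun t => sq_nonneg _) (hrhs n)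
      (Eventually.of_forall (hdle n))
  have hdlim : Tendsto (fun n => ∫ t, d n t ∂m) atTop (𝓝 0) := by
    have h1 := ((Real.continuous_exp.tendsto _).comp hint).const_mul 2 |>.const_sub 2
    rw [Real.exp_zero, mul_one, sub_self] at h1
    exact squeeze_zero (fun n => integral_nonneg fun t => sq_nonneg _) hdint h1
  have hdi : ∀ n, Integrable (d n) m := fun n =>
    (hrhs n).mono' (hdm n) (Eventually.of_forall fun t => by
      rw [Real.norm_of_nonneg (sq_nonneg _)]; exact hdle n t)
  have hmeas : TendstoInMeasure m d atTop (fun _ => 0) := by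
    refine tendstoInMeasure_of_tendsto_eLpNorm one_ne_zero hdm aestronglyMeasurable_const ?_
    have h1 := ENNReal.tendsto_ofReal hdlim
    rw [ENNReal.ofReal_zero] at h1
    refine h1.congr fun n => ?_
    have h2 : (d n - fun _ => 0) = d n := by ext t; simp
    rw [h2, eLpNorm_one_eq_lintegral_enorm, ← ofReal_integral_norm_eq_lintegral_enorm (hdi n)]
    congr 1
    exact integral_congr_ae (Eventually.of_forall fun t =>
      (Real.norm_of_nonneg (sq_nonneg _)).symm)
  obtain ⟨ns, hns, h⟩ := hmeas.exists_seq_tendsto_ae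
  refine ⟨ns, hns, ?_⟩
  filter_upwards [h] with t ht
  rw [tendsto_iff_norm_sub_tendsto_zero]
  have h1 := (Real.continuous_sqrt.tendsto _).comp ht
  rw [Real.sqrt_zero] at h1
  refine h1.congr fun k => ?_
  simp only [Function.comp, hd]
  rw [Real.sqrt_sq (norm_nonneg _)]

/-- Multiplication by an outer function maps `H¹` to `H¹` as long as the product is integrable. With
`F = 1` this says that integrable outer functions belong to `H¹`; with `-u` in place of `u` it says
that one may divide by outer functions. -/
theorem outerBdry_mul (hu : Integrable u m) (hF : MemHardy 1 F)
    (hi : Integrable (fun t => outerBdry u t * F t) m) :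
    MemHardy 1 (fun t => outerBdry u t * F t) ∧
      fourierCoeff (fun t => outerBdry u t * F t) 0 =
        (Real.exp (∫ t, u t ∂m) : ℂ) * fourierCoeff F 0 := by
  -- `u + w n = min u n` is bounded above, and `outerBdry (w n)` is bounded by `1` and tends to `1`.
  obtain ⟨ns, hns, hlim⟩ := exists_subseq_tendsto_one hu
  set w : ℕ → Circ → ℝ := fun n t => -max (u t - (n : ℝ)) 0 with hw
  have hwi : ∀ n, Integrable (w n) m := fun n =>
    ((hu.sub (integrable_const (n : ℝ))).sup (integrable_zero _ _ _)).neg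
  have hle : ∀ (n : ℕ) t, u t + w n t ≤ n := fun n t => by
    simp only [hw]; linarith [le_max_left (u t - (n : ℝ)) 0]
  have hadd : ∀ n, (fun t => outerBdry (fun t => u t + w n t) t * F t) =ᵐ[m]
      fun t => outerBdry (w n) t * (outerBdry u t * F t) := fun n => by
    filter_upwards [outerBdry_add hu (hwi n)] with t ht
    rw [ht]; ring
  have hco : ∀ n : ℤ, Tendsto (fun k => fourierCoeff
      (fun t => outerBdry (fun t => u t + w (ns k) t) t * F t) n) atTop
      (𝓝 (fourierCoeff (fun t => outerBdry u t * F t) n)) := by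
    intro n
    have h := tendsto_fourierCoeff (b := fun t => ‖outerBdry u t * F t‖)
      (G := fun k t => outerBdry (w (ns k)) t * (outerBdry u t * F t))
      (G₀ := fun t => outerBdry u t * F t)
      (fun k => (aestronglyMeasurable_outerBdry (hwi _)).mul hi.aestronglyMeasurable) hi.norm
      (fun k => Eventually.of_forall fun t => ?_) ?_ n
    · refine h.congr fun k => ?_
      rw [fourierCoeff_congr_ae (hadd (ns k))]
    · rw [norm_mul (outerBdry _ _), norm_outerBdry]
      refine mul_le_of_le_one_left (norm_nonneg _) (Real.exp_le_one_iff.2 ?_)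
      exact neg_nonpos.2 (le_max_right _ _)
    · filter_upwards [hlim] with t ht
      simpa using ht.mul_const (outerBdry u t * F t)
  have hb : ∀ k, _ := fun k => outerBdry_mul_of_le (hu.add (hwi (ns k))) (hle (ns k)) hF
  refine ⟨⟨memLp_one_iff_integrable.2 hi, fun n hn => tendsto_nhds_unique (hco n)
    (tendsto_const_nhds.congr fun k => ((hb k).1.2 n hn).symm)⟩,
    tendsto_nhds_unique (hco 0) ?_⟩
  have hint : Tendsto (fun k => ∫ t, (u t + w (ns k) t) ∂m) atTop (𝓝 (∫ t, u t ∂m)) := by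
    refine tendsto_integral_of_dominated_convergence (fun t => ‖u t‖)
      (fun k => (hu.add (hwi (ns k))).aestronglyMeasurable) hu.norm
      (fun k => Eventually.of_forall fun t => ?_) (Eventually.of_forall fun t => ?_)
    · have h0 : (0 : ℝ) ≤ ns k := Nat.cast_nonneg _
      simp only [hw]
      rcases le_total (u t - (ns k : ℝ)) 0 with h | h
      · rw [max_eq_right h]; simp
      · rw [max_eq_left h, Real.norm_of_nonneg (by linarith), Real.norm_of_nonneg (by linarith)]
        linarith
    · refine tendsto_const_nhds.congr' ?_
      filter_upwards [eventually_ge_atTop ⌈u t⌉₊] with k hk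
      have h1 : ⌈u t⌉₊ ≤ ns k := hk.trans (hns.id_le k)
      have : u t ≤ ns k := (Nat.le_ceil _).trans (by exact_mod_cast h1)
      simp only [hw]
      rw [max_eq_right (by linarith), neg_zero, add_zero]
  have h1 := ((Complex.continuous_ofReal.comp Real.continuous_exp).tendsto _).comp hint
  exact (h1.mul_const (fourierCoeff F 0)).congr fun k => (hb k).2.symm

/-! ### Products, logarithmic integrability and real functions in Hardy spaces -/

theorem hasSum_inner_fourier (x y : Lp ℂ 2 m) :
    HasSum (fun i : ℤ => inner ℂ x (fourierLp 2 i) * fourierCoeff y i) (inner ℂ x y) := by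
  have h := (fourierBasis (T := 1)).hasSum_inner_mul_inner x y
  simpa only [coe_fourierBasis, ← fourierCoeff_eq_inner] using h

theorem inner_eq_integral_conj_mul (x y : Lp ℂ 2 m) :
    inner ℂ x y = ∫ t, conj (x t) * y t ∂m := by
  rw [L2.inner_def]
  refine integral_congr_ae (Eventually.of_forall fun t => ?_)
  simp only [RCLike.inner_apply]
  ring

/-- The product of two functions in `H²` is in `H¹`, by Parseval's identity. -/
theorem MemHardy.mul {f h : Circ → ℂ} (hf : MemHardy 2 f) (hh : MemHardy 2 h) :
    MemHardy 1 fun t => f t * h t := by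
  refine ⟨memLp_one_iff_integrable.2 (hf.1.integrable_mul hh.1), fun n hn => ?_⟩
  have hx : MemLp (fun t => conj (fourier (-n) t * f t)) 2 m := by
    refine MemLp.star (f := fun t => fourier (-n) t * f t) ?_
    exact hf.1.of_le ((fourier (-n)).continuous.aestronglyMeasurable.mul hf.1.1)
      (Eventually.of_forall fun t => by rw [norm_mul, norm_fourier_apply, one_mul])
  have hp : fourierCoeff (fun t => f t * h t) n = inner ℂ (hx.toLp _) (hh.1.toLp _) := by
    rw [inner_eq_integral_conj_mul, fourierCoeff_eq_integral_mul]
    refine integral_congr_ae ?_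
    filter_upwards [hx.coeFn_toLp, hh.1.coeFn_toLp] with t h1 h2
    rw [h1, h2, Complex.conj_conj, mul_assoc]
  rw [hp, ← (hasSum_inner_fourier _ _).tsum_eq]
  refine (tsum_congr fun i => ?_).trans tsum_zero
  rw [fourierCoeff_congr_ae hh.1.coeFn_toLp]
  rcases lt_or_ge i 0 with hi | hi
  · rw [hh.2 i hi, mul_zero]
  · have : inner ℂ (hx.toLp _) (fourierLp 2 i) = fourierCoeff f (n - i) := by
      rw [inner_eq_integral_conj_mul, fourierCoeff_eq_integral_mul]
      refine integral_congr_ae ?_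
      filter_upwards [hx.coeFn_toLp, coeFn_fourierLp (T := 1) 2 i] with t h1 h2
      rw [h1, h2, Complex.conj_conj, neg_sub, sub_eq_add_neg, fourier_add]
      ring
    rw [this, hf.2 _ (by omega), zero_mul]

/-- The truncated logarithms `log (max x (e⁻ⁿ))` are bounded above by `x` and below by `-n`. -/
theorem log_max_exp_bounds {x : ℝ} (hx : 0 ≤ x) (n : ℕ) :
    -(n : ℝ) ≤ Real.log (max x (Real.exp (-n))) ∧ Real.log (max x (Real.exp (-n))) ≤ x := by
  constructor
  · rw [Real.le_log_iff_exp_le (lt_max_of_lt_right (Real.exp_pos _))]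
    exact le_max_right _ _
  · rw [Real.log_le_iff_le_exp (lt_max_of_lt_right (Real.exp_pos _))]
    refine max_le ((Real.add_one_le_exp x).trans' (by linarith)) (Real.exp_le_exp.2 ?_)
    have : (0 : ℝ) ≤ n := Nat.cast_nonneg n
    linarith

/-- Jensen's inequality: a function in `H¹` with nonzero mean has integrable logarithm. It follows
by dividing by the outer functions with moduli `max ‖F‖ (e⁻ⁿ)`: the quotients are bounded by `1`, and
so are their means. -/
theorem MemHardy.log_integrable_of_mean (hF : MemHardy 1 F) (h0 : fourierCoeff F 0 ≠ 0) :
    (∀ᵐ t ∂m, F t ≠ 0) ∧ Integrable (fun t => Real.log ‖F t‖) m := by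
  set l : ℕ → Circ → ℝ := fun n t => Real.log (max ‖F t‖ (Real.exp (-n))) with hl
  have hFi := hF.integrable
  have hlb : ∀ (n : ℕ) t, -(n : ℝ) ≤ l n t ∧ l n t ≤ ‖F t‖ := fun n t =>
    log_max_exp_bounds (norm_nonneg _) n
  have hlm : ∀ n, AEStronglyMeasurable (l n) m := fun n =>
    (Real.measurable_log.comp_aemeasurable
      (hFi.norm.aemeasurable.max aemeasurable_const)).aestronglyMeasurable
  have hli : ∀ n, Integrable (l n) m := fun n => by
    refine (hFi.norm.add (integrable_const (n : ℝ))).mono' (hlm n) (Eventually.of_forall fun t => ?_)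
    have hn : (0 : ℝ) ≤ n := Nat.cast_nonneg n
    have hp := norm_nonneg (F t)
    rw [Real.norm_eq_abs, abs_le]
    simp only [Pi.add_apply]
    exact ⟨by linarith [(hlb n t).1], by linarith [(hlb n t).2]⟩
  have hjensen : ∀ n, Real.log ‖fourierCoeff F 0‖ ≤ ∫ t, l n t ∂m := by
    intro n
    have hq := (outerBdry_mul_of_le (hli n).neg (C := n)
      (fun t => by simp only [Pi.neg_apply]; linarith [(hlb n t).1]) hF).2
    have hle : ‖fourierCoeff (fun t => outerBdry (-l n) t * F t) 0‖ ≤ 1 := by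
      rw [fourierCoeff_zero_eq]
      refine (norm_integral_le_of_norm_le_const (C := 1) (Eventually.of_forall fun t => ?_)).trans
        (by simp)
      rw [norm_mul, norm_outerBdry, Pi.neg_apply, Real.exp_neg, hl]
      simp only
      rw [Real.exp_log (lt_max_of_lt_right (Real.exp_pos _)), inv_mul_le_iff₀
        (lt_max_of_lt_right (Real.exp_pos _)), mul_one]
      exact le_max_left _ _
    rw [hq, norm_mul, Complex.norm_real, Real.norm_of_nonneg (Real.exp_pos _).le] at hle
    simp only [Pi.neg_apply] at hle
    rw [integral_neg, Real.exp_neg, inv_mul_le_iff₀ (Real.exp_pos _), mul_one] at hle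
    rwa [Real.log_le_iff_le_exp (norm_pos_iff.2 h0)]
  set B : ℝ := (∫ t, ‖F t‖ ∂m) - Real.log ‖fourierCoeff F 0‖ with hB
  set ψ : ℕ → Circ → ℝ≥0∞ := fun n t => ENNReal.ofReal (‖F t‖ - l n t) with hψ
  have hψm : ∀ n, AEMeasurable (ψ n) m := fun n =>
    (hFi.norm.aemeasurable.sub (hli n).aemeasurable).ennreal_ofReal
  have hmono : ∀ t, Monotone fun n => ψ n t := by
    intro t a b hab
    refine ENNReal.ofReal_le_ofReal (sub_le_sub_left ?_ _)
    refine Real.log_le_log (lt_max_of_lt_right (Real.exp_pos _)) (max_le_max_left _ ?_)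
    refine Real.exp_le_exp.2 (neg_le_neg ?_)
    exact_mod_cast hab
  have hfin : ∫⁻ t, ⨆ n, ψ n t ∂m < ∞ := by
    rw [lintegral_iSup' hψm (Eventually.of_forall hmono)]
    refine lt_of_le_of_lt (iSup_le fun n => ?_) (ENNReal.ofReal_lt_top (r := B))
    rw [hψ]
    simp only
    rw [← ofReal_integral_eq_lintegral_ofReal (f := fun t => ‖F t‖ - l n t)
      (hFi.norm.sub (hli n))
      (Eventually.of_forall fun t => sub_nonneg.2 (hlb n t).2)]
    refine ENNReal.ofReal_le_ofReal ?_
    refine (integral_sub hFi.norm (hli n)).trans_le ?_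
    exact sub_le_sub_left (hjensen n) _
  have hlt := ae_lt_top' (AEMeasurable.iSup hψm) hfin.ne
  have hne : ∀ᵐ t ∂m, F t ≠ 0 := by
    filter_upwards [hlt] with t ht h
    obtain ⟨n, hn⟩ := ENNReal.exists_nat_gt ht.ne
    have h1 : ψ n t = n := by
      simp only [hψ, hl, h, norm_zero]
      rw [max_eq_right (Real.exp_pos _).le, Real.log_exp, zero_sub, neg_neg,
        ENNReal.ofReal_natCast]
    exact absurd (le_iSup (fun n => ψ n t) n) (by rw [h1]; exact not_le.2 hn)
  refine ⟨hne, ?_⟩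
  have hlogm : AEStronglyMeasurable (fun t => Real.log ‖F t‖) m :=
    (Real.measurable_log.comp_aemeasurable hFi.norm.aemeasurable).aestronglyMeasurable
  have hdiff : Integrable (fun t => ‖F t‖ - Real.log ‖F t‖) m := by
    refine ⟨hFi.norm.aestronglyMeasurable.sub hlogm, ?_⟩
    refine lt_of_le_of_lt (lintegral_mono_ae ?_) hfin
    filter_upwards [hne] with t ht
    have hpos : 0 < ‖F t‖ := norm_pos_iff.2 ht
    have h1 : 0 ≤ ‖F t‖ - Real.log ‖F t‖ := by linarith [Real.log_le_sub_one_of_pos hpos]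
    obtain ⟨n, hn⟩ := exists_nat_ge (-Real.log ‖F t‖)
    have h2 : l n t = Real.log ‖F t‖ := by
      simp only [hl]
      rw [max_eq_left]
      rw [← Real.le_log_iff_exp_le hpos]; linarith
    refine le_trans (le_of_eq ?_) (le_iSup (fun n => ψ n t) n)
    rw [Real.enorm_eq_ofReal h1]
    simp only [hψ, h2]
  refine (hFi.norm.sub hdiff).congr (Eventually.of_forall fun t => ?_)
  simp

/-- The logarithm of a nonzero function in `H¹` is integrable. -/
theorem MemHardy.log_integrable (hF : MemHardy 1 F) (h0 : ¬ F =ᵐ[m] 0) :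
    (∀ᵐ t ∂m, F t ≠ 0) ∧ Integrable (fun t => Real.log ‖F t‖) m := by
  have hex : ∃ n : ℕ, fourierCoeff F n ≠ 0 := by
    by_contra! h
    refine h0 (ae_eq_zero_of_fourierCoeff hF.integrable fun n => ?_)
    rcases lt_or_ge n 0 with hn | hn
    · exact hF.2 n hn
    · obtain ⟨k, rfl⟩ := Int.eq_ofNat_of_zero_le hn
      exact h k
  classical
  -- Dividing by a power of `z` reduces to the case of a nonzero mean.
  set k := Nat.find hex with hk
  have hcoef : ∀ n : ℤ, fourierCoeff (fun t => fourier (-(k : ℤ)) t * F t) n =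
      fourierCoeff F (n + k) := by
    intro n
    rw [fourierCoeff_eq_integral_mul, fourierCoeff_eq_integral_mul]
    refine integral_congr_ae (Eventually.of_forall fun t => ?_)
    simp only
    rw [neg_add, fourier_add, mul_assoc]
  have hG : MemHardy 1 fun t => fourier (-(k : ℤ)) t * F t := by
    refine ⟨memLp_one_iff_integrable.2
      (integrable_continuous_mul (fourier _).continuous hF.integrable), fun n hn => ?_⟩
    rw [hcoef]
    rcases lt_or_ge (n + k) 0 with h | h
    · exact hF.2 _ h
    · obtain ⟨j, hj⟩ := Int.eq_ofNat_of_zero_le h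
      rw [hj]
      exact not_not.1 (Nat.find_min hex (show j < Nat.find hex by omega))
  have h1 := hG.log_integrable_of_mean (by rw [hcoef, zero_add]; exact Nat.find_spec hex)
  simp only [norm_mul, norm_fourier_apply, one_mul] at h1
  refine ⟨?_, h1.2⟩
  filter_upwards [h1.1] with t ht
  exact right_ne_zero_of_mul ht

/-- A real-valued function in `H¹` is constant. -/
theorem MemHardy.ae_eq_const_of_real (hF : MemHardy 1 F) (hr : ∀ᵐ t ∂m, (F t).im = 0) :
    ∃ c : ℂ, ∀ᵐ t ∂m, F t = c := by
  refine ⟨fourierCoeff F 0, ?_⟩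
  have hpos : ∀ n : ℤ, n ≠ 0 → fourierCoeff F n = 0 := by
    intro n hn
    rcases lt_or_gt_of_ne hn with h | h
    · exact hF.2 n h
    · have h1 : fourierCoeff F n = conj (fourierCoeff F (-n)) := by
        rw [fourierCoeff_eq_integral_mul, fourierCoeff_eq_integral_mul, ← integral_conj]
        refine integral_congr_ae ?_
        filter_upwards [hr] with t ht
        rw [map_mul, ← fourier_neg, neg_neg, Complex.conj_eq_iff_im.2 ht]
      rw [h1, hF.2 _ (by omega), map_zero]
  have h := ae_eq_zero_of_fourierCoeff (hF.integrable.sub (integrable_const (fourierCoeff F 0)))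
    fun n => by
      have e : fourierCoeff (F - fun _ => fourierCoeff F 0) n =
          fourierCoeff F n - fourierCoeff (fun _ : Circ => fourierCoeff F 0) n := by
        generalize fourierCoeff F 0 = c
        rw [fourierCoeff_eq_integral_mul, fourierCoeff_eq_integral_mul,
          fourierCoeff_eq_integral_mul, ← integral_sub
            (integrable_continuous_mul (fourier _).continuous hF.integrable)
            (integrable_continuous_mul (fourier _).continuous (integrable_const _))]
        refine integral_congr_ae (Eventually.of_forall fun t => ?_)
        simp only [Pi.sub_apply, mul_sub]
      rw [e]
      by_cases hn : n = 0
      · subst hn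
        rw [fourierCoeff_zero_eq (fun _ => fourierCoeff F 0)]
        simp
      · rw [hpos n hn, fourierCoeff_const _ hn, sub_zero]
  filter_upwards [h] with t ht
  exact sub_eq_zero.1 ht

/-! ### Toeplitz kernels and the set `V φ` -/

/-- The conjugate-linear map `x ↦ conj z * conj x` exchanges nonnegative and negative
frequencies. -/
theorem fourierCoeff_conj_z_mul_conj (x : Circ → ℂ) (n : ℤ) :
    fourierCoeff (fun t => conj (z t) * conj (x t)) n = conj (fourierCoeff x (-n - 1)) := by
  rw [fourierCoeff_eq_integral_mul, fourierCoeff_eq_integral_mul, ← integral_conj]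
  refine integral_congr_ae (Eventually.of_forall fun t => ?_)
  have h : (fourier (-(-n - 1)) t : ℂ) = fourier n t * z t := by
    rw [neg_sub, sub_neg_eq_add, add_comm, fourier_add, fourier_eq_z_zpow 1, zpow_one]
  simp only
  rw [h, map_mul, map_mul, ← fourier_neg, mul_assoc]

theorem mem_H2_iff (x : Lp ℂ 2 m) : x ∈ H2 ↔ ∀ n : ℤ, n < 0 → fourierCoeff x n = 0 :=
  ⟨fun h => h.2, fun h => ⟨Lp.memLp x, h⟩⟩

theorem mem_H2_orthogonal_iff (x : Lp ℂ 2 m) :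
    x ∈ H2ᗮ ↔ ∀ n : ℤ, 0 ≤ n → fourierCoeff x n = 0 := by
  rw [Submodule.mem_orthogonal]
  constructor
  · intro h n hn
    rw [fourierCoeff_eq_inner]
    refine h _ ((mem_H2_iff _).2 fun k hk => ?_)
    rw [fourierCoeff_congr_ae (coeFn_fourierLp (T := 1) 2 n), fourierCoeff_fourier,
      Pi.single_apply, if_neg (by omega)]
  · intro h y hy
    rw [← (hasSum_inner_fourier y x).tsum_eq]
    refine (tsum_congr fun i => ?_).trans tsum_zero
    rcases lt_or_ge i 0 with hi | hi
    · rw [← inner_conj_symm, ← fourierCoeff_eq_inner, (mem_H2_iff y).1 hy i hi, map_zero, zero_mul]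
    · rw [h i hi, mul_zero]

theorem memLp_conj_mul {p : ℝ≥0∞} (φ : Lp ℂ ∞ m) {f : Circ → ℂ} (hf : MemLp f p m) :
    MemLp (fun t => conj (z t) * conj (φ t) * f t) p m := by
  have h1 : MemLp (fun t => conj (φ t) * f t) p m := hf.mul (p := ∞) (Lp.memLp φ).star
  refine h1.of_le ?_ (Eventually.of_forall fun t => ?_)
  · simp_rw [mul_assoc]
    exact (Complex.continuous_conj.comp continuous_z).aestronglyMeasurable.mul h1.1
  · rw [mul_assoc, norm_mul, RCLike.norm_conj, norm_z, one_mul]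

/-- Membership in the kernel of a Toeplitz operator as membership in a Hardy space. -/
theorem mem_K2_iff (φ : Lp ℂ ∞ m) (f : H2) : f ∈ K2 φ ↔
    MemHardy 2 fun t => conj (z t) * conj (φ t) * conj ((f : Lp ℂ 2 m) t) := by
  have h0 : f ∈ K2 φ ↔ (φ • (f : Lp ℂ 2 m) : Lp ℂ 2 m) ∈ H2ᗮ :=
    Submodule.orthogonalProjectionOnto_eq_zero_iff
  have hco : ∀ n : ℤ,
      fourierCoeff (fun t => conj (z t) * conj (φ t) * conj ((f : Lp ℂ 2 m) t)) n =
        conj (fourierCoeff (φ • (f : Lp ℂ 2 m) : Lp ℂ 2 m) (-n - 1)) := by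
    intro n
    rw [← fourierCoeff_conj_z_mul_conj]
    refine congrFun (fourierCoeff_congr_ae (E := ℂ) ?_) n
    filter_upwards [Lp.coeFn_lpSMul (𝕜 := ℂ) (r := 2) φ (f : Lp ℂ 2 m)] with t ht
    rw [ht, Pi.smul_apply', smul_eq_mul, map_mul, mul_assoc]
  rw [h0, mem_H2_orthogonal_iff]
  constructor
  · refine fun h => ⟨memLp_conj_mul φ (Lp.memLp _).star, fun n hn => ?_⟩
    rw [hco, h _ (by omega), map_zero]
  · intro h n hn
    have h1 := h.2 (-n - 1) (by omega)
    rw [hco] at h1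
    have e : -(-n - 1) - 1 = n := by ring
    rw [e] at h1
    exact (map_eq_zero _).1 h1

theorem norm_sq_eq_integral (f : Lp ℂ 2 m) : ‖f‖ ^ 2 = ∫ t, ‖f t‖ ^ 2 ∂m := by
  have h : ((‖f‖ ^ 2 : ℝ) : ℂ) = ((∫ t, ‖f t‖ ^ 2 ∂m : ℝ) : ℂ) := by
    have h1 := inner_self_eq_norm_sq_to_K (𝕜 := ℂ) f
    rw [inner_eq_integral_conj_mul] at h1
    push_cast
    refine h1.symm.trans ?_
    rw [← integral_complex_ofReal]
    refine integral_congr_ae (Eventually.of_forall fun t => ?_)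
    simp only
    rw [mul_comm, Complex.mul_conj, Complex.normSq_eq_norm_sq]
  exact_mod_cast h

/-- The function attached to `g` whose membership in `H¹` decides membership of `g` in `V φ`. -/
def companion (φ : Lp ℂ ∞ m) (g : Circ → ℝ) (t : Circ) : ℂ :=
  conj (z t) * conj (φ t) * ((g t : ℝ) : ℂ)

theorem norm_companion (φ : Lp ℂ ∞ m) (g : Circ → ℝ) (t : Circ) :
    ‖companion φ g t‖ = ‖φ t‖ * |g t| := by
  rw [companion, norm_mul, norm_mul, RCLike.norm_conj, RCLike.norm_conj, norm_z, one_mul,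
    Complex.norm_real, Real.norm_eq_abs]

/-- If `V φ` has an element `g`, then `φ` has integrable logarithm, `g` is positive almost everywhere
and the companion function of `g` belongs to `H¹`. -/
theorem of_mem_V (hφ : φ ≠ 0) {g : Lp ℝ 1 m} (hg : g ∈ V φ) :
    MemHardy 1 (companion φ g) ∧ (∀ᵐ t ∂m, 0 < g t) ∧ (∀ᵐ t ∂m, φ t ≠ 0) ∧
      Integrable (fun t => Real.log ‖φ t‖) m := by
  -- For `g = ‖f‖²` the companion function is the product of `f` and `conj z * conj φ * conj f`, both in
  -- `H²`; the logarithm of `‖φ‖` is the difference of those of their moduli.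
  obtain ⟨f, hfK, hf0, -, hfg⟩ := hg
  have hh := (mem_K2_iff φ f).1 hfK
  have hf : MemHardy 2 (f : Lp ℂ 2 m) := f.2
  have hfne : ¬ ((f : Lp ℂ 2 m) : Circ → ℂ) =ᵐ[m] 0 := by
    intro h
    rw [← Lp.eq_zero_iff_ae_eq_zero] at h
    rw [Submodule.coe_norm, h, norm_zero] at hf0
    exact lt_irrefl _ hf0
  obtain ⟨hf1, hf2⟩ := (memHardy_one_of_two hf).log_integrable hfne
  have hhne : ¬ (fun t => conj (z t) * conj (φ t) * conj ((f : Lp ℂ 2 m) t)) =ᵐ[m] 0 := by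
    intro h
    refine hφ (Lp.eq_zero_iff_ae_eq_zero.2 ?_)
    filter_upwards [h, hf1] with t ht ht1
    simpa [z_ne_zero, ht1] using ht
  obtain ⟨hh1, hh2⟩ := (memHardy_one_of_two hh).log_integrable hhne
  have hφ0 : ∀ᵐ t ∂m, φ t ≠ 0 := by
    filter_upwards [hh1] with t ht h
    simp [h] at ht
  refine ⟨(hh.mul hf).congr ?_, ?_, hφ0, ?_⟩
  · filter_upwards [hfg] with t ht
    rw [companion, ht, mul_assoc, mul_comm (conj ((f : Lp ℂ 2 m) t)), Complex.mul_conj,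
      Complex.normSq_eq_norm_sq]
  · filter_upwards [hfg, hf1] with t ht ht1
    rw [ht]; positivity
  · refine (hh2.sub hf2).congr ?_
    filter_upwards [hφ0, hf1] with t h1 h2
    simp only [Pi.sub_apply, norm_mul, RCLike.norm_conj, norm_z, one_mul]
    rw [Real.log_mul (norm_ne_zero_iff.2 h1) (norm_ne_zero_iff.2 h2), add_sub_cancel_right]

theorem memHardy_two_of_one (hF : MemHardy 1 F) (h : MemLp F 2 m) : MemHardy 2 F := ⟨h, hF.2⟩

theorem memHardy_outerBdry (hu : Integrable u m)
    (hi : Integrable (fun t => Real.exp (u t)) m) : MemHardy 1 (outerBdry u) := by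
  have h := outerBdry_mul (F := fun _ => 1) hu (memHardy_const 1) (by
    simp only [mul_one]
    exact hi.mono' (aestronglyMeasurable_outerBdry hu)
      (Eventually.of_forall fun t => (norm_outerBdry u t).le))
  simpa only [mul_one] using h.1

/-- A positive function in the unit ball of `L¹` whose companion function lies in `H¹` belongs to
`V φ`: it is the squared modulus of an outer function in the kernel of the Toeplitz operator. -/
theorem mem_V_of_companion (hφ0 : ∀ᵐ t ∂m, φ t ≠ 0)
    (hφl : Integrable (fun t => Real.log ‖φ t‖) m) {g : Lp ℝ 1 m} (hg0 : ∀ᵐ t ∂m, 0 ≤ g t)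
    (hF : MemHardy 1 (companion φ g)) (hpos : 0 < ‖g‖) (hle : ‖g‖ ≤ 1) : g ∈ V φ := by
  have hne : ¬ companion φ g =ᵐ[m] 0 := by
    intro h
    refine norm_pos_iff.1 hpos (Lp.eq_zero_iff_ae_eq_zero.2 ?_)
    filter_upwards [h, hφ0] with t ht h1
    simpa [companion, z_ne_zero, h1] using ht
  obtain ⟨hF0, hFl⟩ := hF.log_integrable hne
  have hg1 : ∀ᵐ t ∂m, 0 < g t := by
    filter_upwards [hF0, hg0] with t h1 h2
    refine lt_of_le_of_ne h2 fun h => h1 ?_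
    simp [companion, ← h]
  have hgi : Integrable g m := L1.integrable_coeFn g
  have hlog : Integrable (fun t => Real.log (g t)) m := by
    refine (hFl.sub hφl).congr ?_
    filter_upwards [hg1, hφ0] with t h1 h2
    rw [Pi.sub_apply, norm_companion, Real.log_mul (norm_ne_zero_iff.2 h2) (abs_pos.2 h1.ne').ne',
      add_sub_cancel_left, abs_of_pos h1]
  set u : Circ → ℝ := fun t => 1 / 2 * Real.log (g t) with hu
  have hui : Integrable u m := hlog.const_mul _
  have hsq : ∀ᵐ t ∂m, ‖outerBdry u t‖ ^ 2 = g t := by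
    filter_upwards [hg1] with t ht
    rw [norm_outerBdry, ← Real.exp_nat_mul, hu]
    simp only
    rw [Nat.cast_ofNat, ← mul_assoc, mul_one_div_cancel two_ne_zero, one_mul, Real.exp_log ht]
  have hf2 : MemLp (outerBdry u) 2 m := by
    rw [memLp_two_iff_integrable_sq_norm (aestronglyMeasurable_outerBdry hui)]
    refine hgi.congr ?_
    filter_upwards [hsq] with t ht using ht.symm
  have hexp : Integrable (fun t => Real.exp (u t)) m := by
    refine (hf2.integrable (by norm_num)).norm.congr (Eventually.of_forall fun t => ?_)
    exact norm_outerBdry u t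
  have hfH : MemHardy 2 (hf2.toLp (outerBdry u)) :=
    (memHardy_two_of_one (memHardy_outerBdry hui hexp) hf2).congr hf2.coeFn_toLp.symm
  have hquot : ∀ᵐ t ∂m, outerBdry (fun t => -u t) t * companion φ g t =
      conj (z t) * conj (φ t) * conj ((hf2.toLp (outerBdry u)) t) := by
    filter_upwards [hf2.coeFn_toLp, hsq, outerBdry_neg_mul hui] with t h1 h2 h3
    have h4 : (g t : ℂ) = outerBdry u t * conj (outerBdry u t) := by
      rw [Complex.mul_conj, Complex.normSq_eq_norm_sq, h2]
    rw [h1, companion, h4]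
    linear_combination conj (z t) * conj (φ t) * conj (outerBdry u t) * h3
  have hL2 : MemLp (fun t => conj (z t) * conj (φ t) * conj ((hf2.toLp (outerBdry u)) t)) 2 m :=
    memLp_conj_mul φ (Lp.memLp _).star
  have hL1 : Integrable (fun t => outerBdry (fun t => -u t) t * companion φ g t) m :=
    (integrable_congr hquot).2 (hL2.integrable (by norm_num))
  have hK : (⟨hf2.toLp (outerBdry u), hfH⟩ : H2) ∈ K2 φ := by
    rw [mem_K2_iff]
    exact memHardy_two_of_one ((outerBdry_mul hui.neg hF hL1).1.congr hquot) hL2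
  have hae : ∀ᵐ t ∂m, g t = ‖(hf2.toLp (outerBdry u)) t‖ ^ 2 := by
    filter_upwards [hf2.coeFn_toLp, hsq] with t h1 h2
    rw [h1, h2]
  have hnorm : ‖hf2.toLp (outerBdry u)‖ ^ 2 = ‖g‖ := by
    rw [norm_sq_eq_integral, L1.norm_eq_integral_norm]
    refine integral_congr_ae ?_
    filter_upwards [hae, hg0] with t h1 h2
    rw [Real.norm_of_nonneg h2, h1]
  refine ⟨⟨hf2.toLp (outerBdry u), hfH⟩, hK, ?_, ?_, hae⟩
  · rw [Submodule.coe_norm]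
    refine lt_of_le_of_ne (norm_nonneg _) fun h => ?_
    simp only at h
    rw [← h] at hnorm
    norm_num at hnorm
    exact hpos.ne hnorm
  · rw [Submodule.coe_norm]
    simp only
    rw [← hnorm] at hle
    exact (pow_le_one_iff_of_nonneg (norm_nonneg _) two_ne_zero).1 hle

/-! ### Extreme points -/

theorem norm_eq_integral_of_nonneg {g : Lp ℝ 1 m} (hg : ∀ᵐ t ∂m, 0 ≤ g t) :
    ‖g‖ = ∫ t, g t ∂m := by
  rw [L1.norm_eq_integral_norm]
  refine integral_congr_ae ?_
  filter_upwards [hg] with t ht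
  rw [Real.norm_of_nonneg ht]

theorem norm_le_one_of_mem_V (hg : g ∈ V φ) : ‖g‖ ≤ 1 := by
  obtain ⟨f, -, -, hf1, hfg⟩ := hg
  rw [norm_eq_integral_of_nonneg (by filter_upwards [hfg] with t ht; rw [ht]; positivity),
    integral_congr_ae hfg, ← norm_sq_eq_integral]
  exact pow_le_one₀ (norm_nonneg _) hf1

/-- If the companion function of `g` is outer, then `g` is an extreme point: for
`g = a g₁ + b g₂` the quotient `g₁ / g` is bounded, is the quotient of the companion functions, and
hence is a real function in `H¹`, that is, a constant. -/
theorem mem_extremePoints_of_isOuter (hφ : φ ≠ 0) (hg : g ∈ V φ) (hg1 : ‖g‖ = 1)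
    (hO : IsOuter (companion φ g)) : g ∈ (V φ).extremePoints ℝ := by
  refine ⟨hg, fun g₁ h₁ g₂ h₂ hseg => ?_⟩
  obtain ⟨a, b, ha, hb, hab, hsum⟩ := hseg
  obtain ⟨c, w, hc, -, hwl, hF⟩ := hO
  obtain ⟨hF₁, hp₁, -, -⟩ := of_mem_V hφ h₁
  obtain ⟨-, hp₂, -, -⟩ := of_mem_V hφ h₂
  obtain ⟨-, hp, -, -⟩ := of_mem_V hφ hg
  -- Norms are at most `1` in `V φ`, so both ends of the segment have norm `1`.
  have hnorm₁ : ‖g₁‖ = 1 := by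
    have e1 := norm_le_one_of_mem_V h₁
    have e2 := norm_le_one_of_mem_V h₂
    have e3 : ‖g‖ ≤ a * ‖g₁‖ + b * ‖g₂‖ := by
      rw [← hsum]
      refine (norm_add_le _ _).trans ?_
      rw [norm_smul, norm_smul, Real.norm_of_nonneg ha.le, Real.norm_of_nonneg hb.le]
    refine le_antisymm e1 ?_
    by_contra! h
    nlinarith
  have hgsum : ∀ᵐ t ∂m, g t = a * g₁ t + b * g₂ t := by
    rw [← hsum]
    filter_upwards [Lp.coeFn_add (a • g₁) (b • g₂), Lp.coeFn_smul a g₁, Lp.coeFn_smul b g₂]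
      with t k1 k2 k3
    rw [k1, Pi.add_apply, k2, k3]; rfl
  set u : Circ → ℝ := fun t => Real.log (w t) with hu
  have hquot : ∀ᵐ t ∂m, outerBdry (fun t => -u t) t * companion φ g₁ t =
      c * ((g₁ t / g t : ℝ) : ℂ) := by
    filter_upwards [hF, outerBdry_neg_mul hwl, hp] with t k1 k2 k3
    have k4 : (g t : ℂ) ≠ 0 := by exact_mod_cast k3.ne'
    have k5 : companion φ g₁ t = companion φ g t * (g₁ t / g t) := by
      rw [companion, companion]; field_simp
    have k6 : companion φ g t = c * outerBdry u t := k1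
    rw [k5, k6]
    push_cast
    linear_combination c * ((g₁ t : ℂ) / g t) * k2
  have hbd : ∀ᵐ t ∂m, ‖c * ((g₁ t / g t : ℝ) : ℂ)‖ ≤ 1 / a := by
    filter_upwards [hgsum, hp, hp₁, hp₂] with t k1 k2 k3 k4
    rw [norm_mul, hc, one_mul, Complex.norm_real, Real.norm_of_nonneg (by positivity),
      div_le_div_iff₀ k2 ha, k1]
    nlinarith [mul_pos hb k4]
  have hm : AEStronglyMeasurable (fun t => c * ((g₁ t / g t : ℝ) : ℂ)) m :=
    (Complex.continuous_ofReal.comp_aestronglyMeasurable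
      ((Lp.aestronglyMeasurable g₁).aemeasurable.div
        (Lp.aestronglyMeasurable g).aemeasurable).aestronglyMeasurable).const_mul c
  have hi : Integrable (fun t => c * ((g₁ t / g t : ℝ) : ℂ)) m :=
    (integrable_const (1 / a)).mono' hm hbd
  have hH : MemHardy 1 fun t => c * ((g₁ t / g t : ℝ) : ℂ) :=
    (outerBdry_mul hwl.neg hF₁ ((integrable_congr hquot).2 hi)).1.congr hquot
  have hH' : MemHardy 1 fun t => ((g₁ t / g t : ℝ) : ℂ) := by
    refine (hH.const_mul (conj c)).congr (Eventually.of_forall fun t => ?_)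
    simp only
    rw [← mul_assoc, mul_comm (conj c), Complex.mul_conj, Complex.normSq_eq_norm_sq, hc]
    simp
  obtain ⟨κ, hκ⟩ := hH'.ae_eq_const_of_real (Eventually.of_forall fun t => Complex.ofReal_im _)
  have hg₁ : ∀ᵐ t ∂m, g₁ t = κ.re * g t := by
    filter_upwards [hκ, hp] with t k1 k2
    rw [← k1, Complex.ofReal_re]
    field_simp
  have hκ1 : κ.re = 1 := by
    have e1 := norm_eq_integral_of_nonneg (hp₁.mono fun t ht => ht.le)
    rw [integral_congr_ae hg₁, integral_const_mul,
      ← norm_eq_integral_of_nonneg (hp.mono fun t ht => ht.le), hg1, hnorm₁, mul_one] at e1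
    exact e1.symm
  refine Lp.ext ?_
  filter_upwards [hg₁] with t ht
  rw [ht, hκ1, one_mul]

/-- A rotation makes a given complex number purely imaginary. -/
theorem exists_unimodular_re_mul_eq_zero (A : ℂ) : ∃ l : ℂ, ‖l‖ = 1 ∧ (l * A).re = 0 := by
  refine ⟨Complex.exp ((Real.pi / 2 - A.arg : ℝ) * Complex.I),
    Complex.norm_exp_ofReal_mul_I _, ?_⟩
  have h : Complex.exp ((Real.pi / 2 - A.arg : ℝ) * Complex.I) * A = ‖A‖ * Complex.I := by
    nth_rewrite 2 [← Complex.norm_mul_exp_arg_mul_I A]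
    have e : ((Real.pi / 2 - A.arg : ℝ) : ℂ) * Complex.I + A.arg * Complex.I =
        Real.pi / 2 * Complex.I := by push_cast; ring
    rw [mul_left_comm, ← Complex.exp_add, e, Complex.exp_pi_div_two_mul_I]
  rw [h]; simp

/-- The inner factor of a nonzero `F ∈ H¹` times `F` is in `H¹`: up to a square root of the outer
factor it is the square of a function in `H²`. -/
theorem memHardy_inner_mul {F : Circ → ℂ} (hF : MemHardy 1 F) (hF0 : ∀ᵐ t ∂m, F t ≠ 0)
    (hl : Integrable (fun t => Real.log ‖F t‖) m) :
    MemHardy 1 fun t => (outerBdry (fun t => -Real.log ‖F t‖) t * F t) * F t := by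
  set u : Circ → ℝ := fun t => 1 / 2 * -Real.log ‖F t‖ with hu
  have hui : Integrable u m := hl.neg.const_mul _
  have hnorm : ∀ᵐ t ∂m, ‖outerBdry u t * F t‖ ^ 2 = ‖F t‖ := by
    filter_upwards [hF0] with t ht
    have hp : 0 < ‖F t‖ := norm_pos_iff.2 ht
    rw [norm_mul, mul_pow, norm_outerBdry, ← Real.exp_nat_mul, hu]
    simp only
    rw [Nat.cast_ofNat, ← mul_assoc, mul_one_div_cancel two_ne_zero, one_mul, Real.exp_neg,
      Real.exp_log hp]
    field_simp
  have hm : AEStronglyMeasurable (fun t => outerBdry u t * F t) m :=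
    (aestronglyMeasurable_outerBdry hui).mul hF.1.1
  have h2 : MemLp (fun t => outerBdry u t * F t) 2 m := by
    rw [memLp_two_iff_integrable_sq_norm hm]
    exact (integrable_congr hnorm).2 hF.integrable.norm
  have hH := memHardy_two_of_one (outerBdry_mul hui hF (h2.integrable (by norm_num))).1 h2
  refine (hH.mul hH).congr ?_
  have hadd := outerBdry_add hui hui
  have e : (fun t => u t + u t) = fun t => -Real.log ‖F t‖ := by
    ext t; simp only [hu]; ring
  rw [e] at hadd
  filter_upwards [hadd] with t ht
  rw [ht]; ring

/-- If `g` is an extreme point, then the inner factor of its companion function is constant: with a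
rotation `J` of the inner factor such that `∫ g Re J = 0`, both functions `g (1 ± Re J)` lie in
`V φ`, and `g` is their midpoint. -/
theorem isOuter_of_mem_extremePoints (hφ : φ ≠ 0) (hg1 : ‖g‖ = 1)
    (hext : g ∈ (V φ).extremePoints ℝ) : IsOuter (companion φ g) := by
  obtain ⟨hgV, hmid⟩ := hext
  obtain ⟨hF, hp, hφ0, hφl⟩ := of_mem_V hφ hgV
  have hgi : Integrable g m := L1.integrable_coeFn g
  have hFne : ¬ companion φ g =ᵐ[m] 0 := by
    intro h
    have : ∀ᵐ _ ∂(m : Measure Circ), False := by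
      filter_upwards [h, hp, hφ0] with t k1 k2 k3
      simp [companion, z_ne_zero, k3, k2.ne'] at k1
    exact this.exists.elim fun _ h => h
  obtain ⟨hF0, hl⟩ := hF.log_integrable hFne
  set F := companion φ g with hFdef
  set u : Circ → ℝ := fun t => Real.log ‖F t‖ with hu
  set I : Circ → ℂ := fun t => outerBdry (fun t => -u t) t * F t with hI
  have hInorm : ∀ᵐ t ∂m, ‖I t‖ = 1 := by
    filter_upwards [hF0] with t ht
    have hpos := norm_pos_iff.2 ht
    simp only [hI, norm_mul, norm_outerBdry, Real.exp_neg, hu, Real.exp_log hpos]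
    exact inv_mul_cancel₀ hpos.ne'
  have hIm : AEStronglyMeasurable I m := (aestronglyMeasurable_outerBdry hl.neg).mul hF.1.1
  have hIi : Integrable I m := (integrable_const (1 : ℝ)).mono' hIm (hInorm.mono fun t ht => ht.le)
  have hIH : MemHardy 1 I := (outerBdry_mul hl.neg hF hIi).1
  have hFI : ∀ᵐ t ∂m, F t = I t * outerBdry u t := by
    filter_upwards [outerBdry_neg_mul hl] with t ht
    simp only [hI]
    linear_combination -F t * ht
  -- It suffices to show that the inner factor is constant.
  suffices hconst : ∃ c, ∀ᵐ t ∂m, I t = c by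
    obtain ⟨c, hc⟩ := hconst
    obtain ⟨t₀, k1, k2⟩ := (hInorm.and hc).exists
    refine ⟨c, fun t => ‖F t‖, by rw [← k2, k1], hF0.mono fun t ht => norm_pos_iff.2 ht, hl, ?_⟩
    filter_upwards [hFI, hc] with t k3 k4
    rw [k3, k4]; rfl
  obtain ⟨l, hl1, hlA⟩ := exists_unimodular_re_mul_eq_zero (∫ t, (g t : ℂ) * I t ∂m)
  set J : Circ → ℂ := fun t => l * I t with hJ
  have hJH : MemHardy 1 J := hIH.const_mul l
  have hJnorm : ∀ᵐ t ∂m, ‖J t‖ = 1 := by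
    filter_upwards [hInorm] with t ht
    simp only [hJ, norm_mul, hl1, ht, mul_one]
  have hv1 : ∀ᵐ t ∂m, |(J t).re| ≤ 1 := by
    filter_upwards [hJnorm] with t ht
    exact (Complex.abs_re_le_norm _).trans ht.le
  have hgv : Integrable (fun t => g t * (J t).re) m := by
    refine hgi.norm.mono' (hgi.1.mul (Complex.continuous_re.comp_aestronglyMeasurable hJH.1.1)) ?_
    filter_upwards [hv1] with t ht
    rw [norm_mul]
    exact mul_le_of_le_one_right (norm_nonneg _) ht
  have hgv0 : ∫ t, g t * (J t).re ∂m = 0 := by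
    have hgI : Integrable (fun t => (g t : ℂ) * I t) m := by
      refine hgi.norm.mono' (hgi.ofReal.1.mul hIm) ?_
      filter_upwards [hInorm] with t ht
      rw [norm_mul, ht, mul_one, Complex.norm_real]
    have h := integral_re (𝕜 := ℂ) (hgI.const_mul l)
    rw [integral_const_mul] at h
    refine Eq.trans (integral_congr_ae (Eventually.of_forall fun t => ?_)) (h.trans hlA)
    have key : ∀ x : ℂ, g t * (l * x).re = (l * (g t * x)).re := fun x => by
      rw [mul_left_comm l, Complex.re_ofReal_mul]
    exact key (I t)
  have hFv : MemHardy 1 fun t => F t * ((J t).re : ℂ) := by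
    have h1 : MemHardy 1 fun t => I t * F t := memHardy_inner_mul hF hF0 hl
    have h2 : MemHardy 1 (outerBdry u) := by
      refine memHardy_outerBdry hl (hF.integrable.norm.congr ?_)
      filter_upwards [hF0] with t ht
      simp only [hu]
      rw [Real.exp_log (norm_pos_iff.2 ht)]
    -- `F Re J = (l I F + conj l (conj I) F) / 2`, and `(conj I) F` is the outer factor of `F`.
    refine ((h1.const_mul (l / 2)).add (h2.const_mul (conj l / 2))).congr ?_
    filter_upwards [hFI, hInorm] with t k1 k2
    have k3 : I t * conj (I t) = 1 := by
      rw [Complex.mul_conj, Complex.normSq_eq_norm_sq, k2]; simp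
    rw [Complex.re_eq_add_conj]
    simp only [hJ, map_mul]
    rw [k1]
    linear_combination -(conj l * outerBdry u t / 2) * k3
  have hperturb : ∀ ε : ℝ, |ε| = 1 → ∃ g' ∈ V φ, ∀ᵐ t ∂m, g' t = g t + ε * (g t * (J t).re) := by
    intro ε hε
    have hi : Integrable (fun t => g t + ε * (g t * (J t).re)) m := hgi.add (hgv.const_mul ε)
    have hco := hi.coeFn_toL1
    have hnn : ∀ᵐ t ∂m, 0 ≤ (hi.toL1 _ : Lp ℝ 1 m) t := by
      filter_upwards [hco, hp, hv1] with t k1 k2 k3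
      rw [k1]
      have k4 : |ε * (J t).re| ≤ 1 := by rw [abs_mul, hε, one_mul]; exact k3
      have k5 := (abs_le.1 k4).1
      nlinarith
    have hn : ‖(hi.toL1 _ : Lp ℝ 1 m)‖ = 1 := by
      rw [norm_eq_integral_of_nonneg hnn, integral_congr_ae hco,
        integral_add hgi (hgv.const_mul ε), integral_const_mul, hgv0, mul_zero, add_zero,
        ← norm_eq_integral_of_nonneg (hp.mono fun t ht => ht.le), hg1]
    refine ⟨hi.toL1 _, mem_V_of_companion hφ0 hφl hnn ?_ (by rw [hn]; exact one_pos) hn.le, hco⟩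
    refine (hF.add (hFv.const_mul ε)).congr ?_
    filter_upwards [hco] with t ht
    simp only [hFdef, companion]
    rw [ht]
    push_cast
    ring
  obtain ⟨g₁, h₁, e₁⟩ := hperturb 1 (by simp)
  obtain ⟨g₂, h₂, e₂⟩ := hperturb (-1) (by simp)
  have hseg : g ∈ openSegment ℝ g₁ g₂ := by
    refine ⟨1 / 2, 1 / 2, by norm_num, by norm_num, by norm_num, Lp.ext ?_⟩
    filter_upwards [Lp.coeFn_add ((1 / 2 : ℝ) • g₁) ((1 / 2 : ℝ) • g₂),
      Lp.coeFn_smul (1 / 2 : ℝ) g₁, Lp.coeFn_smul (1 / 2 : ℝ) g₂, e₁, e₂] with t k1 k2 k3 k4 k5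
    rw [k1, Pi.add_apply, k2, k3, Pi.smul_apply, Pi.smul_apply, k4, k5, smul_eq_mul, smul_eq_mul]
    ring
  have heq := hmid h₁ h₂ hseg
  have hre : ∀ᵐ t ∂m, (J t).re = 0 := by
    rw [heq] at e₁
    filter_upwards [e₁, hp] with t k1 k2
    have : g t * (J t).re = 0 := by linarith
    exact (mul_eq_zero.1 this).resolve_left k2.ne'
  obtain ⟨κ, hκ⟩ := (hJH.const_mul Complex.I).ae_eq_const_of_real
    (by filter_upwards [hre] with t ht; simpa using ht)
  have hl0 : l ≠ 0 := by rw [← norm_ne_zero_iff, hl1]; exact one_ne_zero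
  refine ⟨κ / (Complex.I * l), ?_⟩
  filter_upwards [hκ] with t ht
  rw [← ht]
  simp only [hJ]
  field_simp

end ToeplitzKernel

end

theorem theorem2 (φ : Lp ℂ ∞ ToeplitzKernel.m) (hφ : φ ≠ 0) (hK : ToeplitzKernel.K2 φ ≠ {0})
    (g : Lp ℝ 1 ToeplitzKernel.m) (hg : g ∈ ToeplitzKernel.V φ) (hg1 : ‖g‖ = 1) :
    g ∈ (ToeplitzKernel.V φ).extremePoints ℝ ↔
      ToeplitzKernel.MemHardy 1
          (fun t => conj (ToeplitzKernel.z t) * conj (φ t) * ((g t : ℝ) : ℂ)) ∧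
        ToeplitzKernel.IsOuter
          (fun t => conj (ToeplitzKernel.z t) * conj (φ t) * ((g t : ℝ) : ℂ)) :=
  ⟨fun h => ⟨(ToeplitzKernel.of_mem_V hφ hg).1,
      ToeplitzKernel.isOuter_of_mem_extremePoints hφ hg1 h⟩,
    fun h => ToeplitzKernel.mem_extremePoints_of_isOuter hφ hg hg1 h.2⟩
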